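/- Let $n\ge 2$. For a set $E\subset\mathbb{R}^m$ consider the properties: (i) no three distinct points of $E$ are collinear; (ii) every direction is realised by $E$ at most once, that is, whenever $x\ne y$ and $z\ne w$ are points of $E$ such that $y-x$ and $w-z$ span the same line through the origin, then $\{x,y\}=\{z,w\}$. (a) There is a compact set $E\subset\mathbb{R}^n$ of Hausdorff dimension $\dim_H E=n-1$ with properties (i) and (ii). Moreover, $E$ can be chosen to be a graph over a planar set: there are a compact set $B\subset\mathbb{R}^2$ of Hausdorff dimension $1$, itself with properties (i) and (ii), and a continuous function $f:B\to\mathbb{R}^{n-2}$ such that $E=\{(b,f(b)) : b\in B\}\subset\mathbb{R}^2\times\mathbb{R}^{n-2}=\mathbb{R}^n$ (so $\dim_H E=\dim_H B+(n-2)$). (b) The dimension $n-1$ is sharp: every Borel set $A\subset\mathbb{R}^n$ with no three distinct collinear points satisfies $\dim_H A\le n-1$. -/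

import Mathlib

open MeasureTheory

/-- `E` does not contain three (distinct) collinear points. -/
def NoThreeCollinear {n : ℕ} (E : Set (EuclideanSpace ℝ (Fin n))) : Prop :=
  ∀ x ∈ E, ∀ y ∈ E, ∀ z ∈ E, x ≠ y → y ≠ z → x ≠ z → ¬ Collinear ℝ {x, y, z}

/-- Every direction is realised by `E` at most once. The direction of a pair of distinct points
`x, y` is the line through the origin spanned by `y - x`; so two pairs of distinct points of `E`
with parallel differences are the same pair, up to exchanging its two points. -/
def DirectionsAtMostOnce {n : ℕ} (E : Set (EuclideanSpace ℝ (Fin n))) : Prop :=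
  ∀ x ∈ E, ∀ y ∈ E, ∀ z ∈ E, ∀ w ∈ E, x ≠ y → z ≠ w →
    Submodule.span ℝ {y - x} = Submodule.span ℝ {w - z} →
      (x = z ∧ y = w) ∨ (x = w ∧ y = z)

/-- The projection of `ℝⁿ` to the plane spanned by the first two coordinate axes. -/
def planeProj {n : ℕ} (hn : 2 ≤ n) (x : EuclideanSpace ℝ (Fin n)) : EuclideanSpace ℝ (Fin 2) :=
  WithLp.toLp 2 fun i => x (Fin.castLE hn i)

/-- The graph over the planar set `B` of `f : ℝ² → ℝⁿ⁻²`, as a subset of `ℝⁿ = ℝ² × ℝⁿ⁻²`. Only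
the values of `f` on `B` matter. -/
def graphOver {n : ℕ} (hn : 2 ≤ n) (B : Set (EuclideanSpace ℝ (Fin 2)))
    (f : EuclideanSpace ℝ (Fin 2) → EuclideanSpace ℝ (Fin (n - 2))) :
    Set (EuclideanSpace ℝ (Fin n)) :=
  {x | planeProj hn x ∈ B ∧
    ∀ i : Fin (n - 2), x ⟨i.val + 2, by omega⟩ = f (planeProj hn x) i}

/-! Upper bound. Suppose a Borel set in `ℝᵐ⁺¹` without collinear triples had dimension above `m`.
Frostman's lemma (`exists_frostman_measure`) gives a probability measure `μ` on a compact subset `K`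
with `μ(B(x, r)) ≲ r ^ s` for some `s > m`. A line meets `K` at most twice, so for each `v` in the
cube `[-1, 1]ᵐ` the projection along `(v, 1)` is injective on each of two Borel pieces of `K`, hence
on a compact `K'` of mass at least `1/4`. By compactness, points of `K'` with nearby projections are
close. Pigeonholing into `δ`-cells then shows that the pairs at distance below `r` whose projections
are `δ`-close have `μ × μ` mass at least `c δ ^ m` for small `δ`, with `c` independent of `r`
(`eventually_le_measure_closePairs`). Averaged over `v`, the same mass is at most `C δ ^ m` times
the `m`-energy of `μ` on pairs closer than `r`, up to dyadic rounding (`measure_closePairs_le`).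
This energy is a tail of a convergent series, so Fatou's lemma gives a contradiction as `r → 0`.

Construction. The planar set is a Cantor set indexed by digit sequences. At stage `j` the digits
choose a cell of a lattice of mesh `1/N`, `N = 2 ^ gridExp m j`, and the next pieces have side about
`N⁻²`. In addition, the pieces with one prescribed beginning of digits are shifted by `1/(4N²)`
along one axis; every beginning and axis is prescribed infinitely often. If `x` is none of `y, z,
w`, take a late stage that shifts `x` but not the others. Were `y - x` and `w - z` parallel, then,
up to a smaller error, `N²` times the cross product of their lattice approximations would be an
integer equal to a quarter of a nonzero coordinate of `w - z`, which has absolute value below 1: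
impossible (`cross_ne_zero_of_lattice`, `cross_planePoint_ne_zero`). So directions do not repeat,
and collinear triples are excluded as a consequence.

Dimension. The number of pieces is nearly the inverse of their side, which yields dimension at least
1 in the plane. The heights read off digits much finer than all earlier scales, so confining a
height coordinate to an interval of length `r` costs a further factor of nearly `r`. The mass
distribution principle (`exists_measure_le_rpow`, `le_dimH_range`) turns this into lower bounds; the
upper bounds are those of the first part. -/

open Set Filter Topology
open scoped ENNReal NNReal

/-! ### Contents on trees and their continuity from below -/

section TreeContent

variable {X Z : Type*}

/-- The total weight of a family `C` of nodes `(k, z)`, a node of level `k` having weight `w k`. -/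
noncomputable def treeCost (w : ℕ → ℝ≥0∞) (C : Set (ℕ × Z)) : ℝ≥0∞ :=
  ∑' p : ℕ × Z, C.indicator (fun p => w p.1) p

/-- The family `C` of nodes covers `S`, where `node k x` is the node of level `k` containing `x`. -/
def TreeCovers (node : ℕ → X → Z) (C : Set (ℕ × Z)) (S : Set X) : Prop :=
  ∀ x ∈ S, ∃ k, (k, node k x) ∈ C

/-- The content of `S`: the least total weight of a family of nodes that covers `S`. -/
noncomputable def treeContent (node : ℕ → X → Z) (w : ℕ → ℝ≥0∞) (S : Set X) : ℝ≥0∞ :=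
  ⨅ (C : Set (ℕ × Z)) (_ : TreeCovers node C S), treeCost w C

/-- The maximal nodes of a family. -/
def maximalNodes (node : ℕ → X → Z) (C : Set (ℕ × Z)) : Set (ℕ × Z) :=
  {p | p ∈ C ∧ ∀ k < p.1, ∀ x, node p.1 x = p.2 → (k, node k x) ∉ C}

/-- The nodes of level `k + 1` refine those of level `k`. -/
def TreeRefines (node : ℕ → X → Z) : Prop :=
  ∀ k l x y, k ≤ l → node l x = node l y → node k x = node k y

variable {node : ℕ → X → Z} {w : ℕ → ℝ≥0∞}

theorem treeCost_iUnion_le {ι : Type*} (C : ι → Set (ℕ × Z)) :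
    treeCost w (⋃ i, C i) ≤ ∑' i, treeCost w (C i) := by
  unfold treeCost
  rw [ENNReal.tsum_comm]
  refine ENNReal.tsum_le_tsum fun p => ?_
  by_cases hp : p ∈ ⋃ i, C i
  · obtain ⟨i, hi⟩ := mem_iUnion.1 hp
    rw [indicator_of_mem hp]
    calc w p.1 = (C i).indicator (fun p => w p.1) p := by rw [indicator_of_mem hi]
      _ ≤ _ := ENNReal.le_tsum i
  · rw [indicator_of_notMem hp]; exact zero_le

theorem treeContent_le {C : Set (ℕ × Z)} {S : Set X} (h : TreeCovers node C S) :
    treeContent node w S ≤ treeCost w C := iInf₂_le C h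

theorem treeContent_mono {S T : Set X} (h : S ⊆ T) :
    treeContent node w S ≤ treeContent node w T :=
  le_iInf₂ fun _ hC => treeContent_le fun x hx => hC x (h hx)

theorem exists_treeCovers_lt {S : Set X} {a : ℝ≥0∞} (h : treeContent node w S < a) :
    ∃ C : Set (ℕ × Z), TreeCovers node C S ∧ treeCost w C < a := by
  simpa [treeContent, iInf_lt_iff] using h

theorem exists_treeCovers_le {S : Set X} (h : treeContent node w S ≠ ⊤) {ε : ℝ≥0∞} (hε : ε ≠ 0) :
    ∃ C : Set (ℕ × Z), TreeCovers node C S ∧ treeCost w C ≤ treeContent node w S + ε := by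
  obtain ⟨C, hC, h'⟩ := exists_treeCovers_lt (ENNReal.lt_add_right h hε)
  exact ⟨C, hC, h'.le⟩

theorem treeContent_empty : treeContent node w ∅ = 0 := by
  refine le_antisymm ((treeContent_le (C := ∅) fun x hx => hx.elim).trans ?_) zero_le
  simp [treeCost]

theorem treeContent_iUnion_le {ι : Type*} [Countable ι] (S : ι → Set X) :
    treeContent node w (⋃ i, S i) ≤ ∑' i, treeContent node w (S i) := by
  by_cases htop : ∑' i, treeContent node w (S i) = ⊤
  · rw [htop]; exact le_top
  refine ENNReal.le_of_forall_pos_le_add fun ε hε _ => ?_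
  obtain ⟨ε', hε', hsum⟩ := ENNReal.exists_pos_sum_of_countable (ENNReal.coe_pos.2 hε).ne' ι
  choose C hC hCc using fun i => exists_treeCovers_le (node := node) (w := w) (S := S i)
    (ENNReal.ne_top_of_tsum_ne_top htop i) (ε := ε' i) (ENNReal.coe_pos.2 (hε' i)).ne'
  calc treeContent node w (⋃ i, S i) ≤ treeCost w (⋃ i, C i) := treeContent_le fun x hx => by
        obtain ⟨i, hi⟩ := mem_iUnion.1 hx
        obtain ⟨k, hk⟩ := hC i x hi
        exact ⟨k, mem_iUnion.2 ⟨i, hk⟩⟩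
    _ ≤ ∑' i, treeCost w (C i) := treeCost_iUnion_le C
    _ ≤ ∑' i, (treeContent node w (S i) + ε' i) := ENNReal.tsum_le_tsum hCc
    _ = ∑' i, treeContent node w (S i) + ∑' i, (ε' i : ℝ≥0∞) := ENNReal.tsum_add
    _ ≤ _ := by gcongr

theorem treeContent_node_le (S : Set X) (k : ℕ) (z : Z) :
    treeContent node w (S ∩ {x | node k x = z}) ≤ w k := by
  refine (treeContent_le (C := {(k, z)}) fun x hx => ⟨k, by simp [hx.2.symm]⟩).trans ?_
  unfold treeCost
  rw [tsum_eq_single (k, z)]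
  · simp
  · intro p hp
    simp [hp]

theorem TreeCovers.maximalNodes (hr : TreeRefines node) {C : Set (ℕ × Z)} {x : X} {k : ℕ}
    (h : (k, node k x) ∈ C) : ∃ l ≤ k, (l, node l x) ∈ maximalNodes node C := by
  classical
  have hex : ∃ k, (k, node k x) ∈ C := ⟨k, h⟩
  refine ⟨Nat.find hex, Nat.find_min' hex h, Nat.find_spec hex, fun l hl y hy hmem => ?_⟩
  exact Nat.find_min hex hl (by rw [← hr l _ y x hl.le hy]; exact hmem)

/-- Strong subadditivity. A point of `S` lies in a node of `C` and in one of `D`; if the levels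
differ, the deeper node is not maximal, otherwise the two coincide. So the non-maximal nodes
together with `C ∩ D` still cover `S`, and no node is counted more often than in `C` and `D`
together. -/
theorem treeCost_maximalNodes_add_le (C D : Set (ℕ × Z)) {S : Set X}
    (hC : TreeCovers node C S) (hD : TreeCovers node D S) :
    treeCost w (maximalNodes node (C ∪ D)) + treeContent node w S ≤
      treeCost w C + treeCost w D := by
  set M := maximalNodes node (C ∪ D)
  have hcov : TreeCovers node (((C ∪ D) \ M) ∪ (C ∩ D)) S := by
    intro x hx
    obtain ⟨k, hk⟩ := hC x hx
    obtain ⟨l, hl⟩ := hD x hx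
    rcases lt_trichotomy k l with h | h | h
    · exact ⟨l, Or.inl ⟨Or.inr hl, fun hM => hM.2 k h x rfl (Or.inl hk)⟩⟩
    · subst h; exact ⟨k, Or.inr ⟨hk, hl⟩⟩
    · exact ⟨k, Or.inl ⟨Or.inl hk, fun hM => hM.2 l h x rfl (Or.inr hl)⟩⟩
  refine (add_le_add_right (treeContent_le hcov) _).trans ?_
  unfold treeCost
  rw [← ENNReal.tsum_add, ← ENNReal.tsum_add]
  refine ENNReal.tsum_le_tsum fun p => ?_
  have hM : p ∈ M → p ∈ C ∨ p ∈ D := fun h => h.1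
  by_cases h1 : p ∈ M <;> by_cases h2 : p ∈ C <;> by_cases h3 : p ∈ D <;>
    simp_all [indicator]

/-- Merge nearly optimal covers of the `S k` one after another, keeping maximal nodes only. Strong
subadditivity makes the errors add up instead of the costs, and the nodes that eventually persist
cover the union. -/
theorem treeContent_iUnion_of_monotone (hr : TreeRefines node) {S : ℕ → Set X} (hS : Monotone S) :
    treeContent node w (⋃ k, S k) ≤ ⨆ k, treeContent node w (S k) := by
  by_cases htop : ⨆ k, treeContent node w (S k) = ⊤
  · rw [htop]; exact le_top
  have hfin : ∀ k, treeContent node w (S k) ≠ ⊤ := fun k =>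
    ne_top_of_le_ne_top htop (le_iSup (fun k => treeContent node w (S k)) k)
  refine ENNReal.le_of_forall_pos_le_add fun ε hε _ => ?_
  obtain ⟨ε', hε', hsum⟩ := ENNReal.exists_pos_sum_of_countable (ENNReal.coe_pos.2 hε).ne' ℕ
  choose D hD hDc using fun k => exists_treeCovers_le (hfin k)
    (ENNReal.coe_pos.2 (hε' k)).ne'
  let E : ℕ → Set (ℕ × Z) := fun k =>
    Nat.rec (D 0) (fun k Ek => maximalNodes node (Ek ∪ D (k + 1))) k
  have hE : ∀ k, E (k + 1) = maximalNodes node (E k ∪ D (k + 1)) := fun k => rfl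
  have hEcov : ∀ k, TreeCovers node (E k) (S k) := by
    intro k
    cases k with
    | zero => exact hD 0
    | succ k =>
      intro x hx
      obtain ⟨l, hl⟩ := hD (k + 1) x hx
      obtain ⟨l', -, h⟩ := TreeCovers.maximalNodes hr (C := E k ∪ D (k + 1)) (Or.inr hl)
      exact ⟨l', h⟩
  have hEcost : ∀ k, treeCost w (E k) ≤
      treeContent node w (S k) + ∑ i ∈ Finset.range (k + 1), (ε' i : ℝ≥0∞) := by
    intro k
    induction k with
    | zero => simpa [E] using hDc 0
    | succ k ih =>
      have h1 := treeCost_maximalNodes_add_le (w := w) (E k) (D (k + 1)) (S := S k) (hEcov k)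
        fun x hx => hD (k + 1) x (hS k.le_succ hx)
      rw [← hE] at h1
      refine ENNReal.le_of_add_le_add_right (hfin k) (h1.trans ((add_le_add ih (hDc (k + 1))).trans
        (le_of_eq ?_)))
      rw [Finset.sum_range_succ _ (k + 1)]
      ring
  let Elim : Set (ℕ × Z) := {p | ∀ᶠ k in atTop, p ∈ E k}
  have hcov : TreeCovers node Elim (⋃ k, S k) := by
    intro x hx
    obtain ⟨k₀, hk₀⟩ := mem_iUnion.1 hx
    have hex : ∃ l, ∃ k ≥ k₀, (l, node l x) ∈ E k := by
      obtain ⟨l, hl⟩ := hEcov k₀ x hk₀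
      exact ⟨l, k₀, le_rfl, hl⟩
    -- A node containing `x` can only be displaced by one of smaller level. The node of the least
    -- level that ever occurs from stage `k₀` on therefore stays forever.
    obtain ⟨m, ⟨k, hk, hmem⟩, hmin⟩ : ∃ m, (∃ k ≥ k₀, (m, node m x) ∈ E k) ∧
        ∀ l < m, ¬ ∃ k ≥ k₀, (l, node l x) ∈ E k :=
      ⟨sInf {l | ∃ k ≥ k₀, (l, node l x) ∈ E k}, Nat.sInf_mem hex, fun l hl =>
        Nat.notMem_of_lt_sInf hl⟩
    refine ⟨m, eventually_atTop.2 ⟨k, fun j' hj' => ?_⟩⟩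
    induction j', hj' using Nat.le_induction with
    | base => exact hmem
    | succ j hj ih =>
      rw [hE]
      refine ⟨Or.inl ih, fun l hl y hy hmem' => ?_⟩
      have hmem'' : (l, node l x) ∈ E j ∪ D (j + 1) := by
        rw [← hr l _ y x (le_of_lt hl) hy]; exact hmem'
      obtain ⟨l', hl', h⟩ := TreeCovers.maximalNodes hr hmem''
      exact hmin l' (lt_of_le_of_lt hl' hl) ⟨j + 1, by omega, h⟩
  refine (treeContent_le hcov).trans ?_
  unfold treeCost
  rw [ENNReal.tsum_eq_iSup_sum]
  refine iSup_le fun F => ?_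
  have hev : ∀ᶠ k in atTop, ∀ p ∈ F, p ∈ Elim → p ∈ E k := by
    rw [eventually_all_finset]
    intro p _
    by_cases hp : p ∈ Elim
    · filter_upwards [hp] with k hk _ using hk
    · exact Eventually.of_forall fun k h => absurd h hp
  obtain ⟨k, hk⟩ := hev.exists
  calc ∑ p ∈ F, Elim.indicator (fun p => w p.1) p
      ≤ ∑ p ∈ F, (E k).indicator (fun p => w p.1) p := by
        refine Finset.sum_le_sum fun p hp => ?_
        by_cases h : p ∈ Elim
        · rw [indicator_of_mem h, indicator_of_mem (hk p hp h)]
        · rw [indicator_of_notMem h]; exact zero_le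
    _ ≤ treeCost w (E k) := ENNReal.sum_le_tsum F
    _ ≤ _ := hEcost k
    _ ≤ _ := by
        gcongr
        · exact le_iSup (fun k => treeContent node w (S k)) k
        · exact (ENNReal.sum_le_tsum _).trans hsum.le

/-- The sequences whose first `k` terms are bounded by those of `n`. -/
def boundedPrefix (k : ℕ) (n : ℕ → ℕ) : Set (ℕ → ℕ) := {α | ∀ i < k, α i ≤ n i}

/-- Choquet's capacitability argument: bound one term of the sequence at a time. As the bound grows
the images increase to the previous one, so continuity from below keeps the content above `a`. -/
theorem exists_bounds_treeContent (hr : TreeRefines node) (g : (ℕ → ℕ) → X) {a : ℝ≥0∞}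
    (ha : a < treeContent node w (range g)) :
    ∃ n : ℕ → ℕ, ∀ k, a < treeContent node w (g '' boundedPrefix k n) := by
  have step : ∀ k (n : ℕ → ℕ), a < treeContent node w (g '' boundedPrefix k n) →
      ∃ N, a < treeContent node w (g '' boundedPrefix (k + 1) (Function.update n k N)) := by
    intro k n h
    by_contra! hcon
    refine absurd h (not_lt.2 ?_)
    have hun : g '' boundedPrefix k n =
        ⋃ N, g '' boundedPrefix (k + 1) (Function.update n k N) := by
      rw [← image_iUnion]
      congr 1
      ext α
      simp only [boundedPrefix, mem_ofPred_eq, mem_iUnion]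
      constructor
      · intro hα
        refine ⟨α k, fun i hi => ?_⟩
        rcases eq_or_ne i k with rfl | hne
        · simp
        · rw [Function.update_of_ne hne]; exact hα i (by omega)
      · rintro ⟨N, hN⟩ i hi
        have := hN i (by omega)
        rwa [Function.update_of_ne (by omega)] at this
    rw [hun]
    refine (treeContent_iUnion_of_monotone hr ?_).trans (iSup_le hcon)
    intro N N' hNN
    refine image_mono fun α hα i hi => (hα i hi).trans ?_
    rcases eq_or_ne i k with rfl | hne
    · simpa using hNN
    · simp [Function.update_of_ne hne]
  choose! N hN using step
  let b : ℕ → ℕ → ℕ := fun k => Nat.rec (fun _ => 0) (fun k n => Function.update n k (N k n)) k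
  have hb : ∀ k, b (k + 1) = Function.update (b k) k (N k (b k)) := fun k => rfl
  have hcont : ∀ k, a < treeContent node w (g '' boundedPrefix k (b k)) := by
    intro k
    induction k with
    | zero => simpa [boundedPrefix] using ha
    | succ k ih => rw [hb]; exact hN k _ ih
  have hstab : ∀ k i, i < k → b k i = b (i + 1) i := by
    intro k i hik
    induction k, hik using Nat.le_induction with
    | base => rfl
    | succ k hk ih => rw [hb, Function.update_of_ne (by omega), ih]
  refine ⟨fun i => b (i + 1) i, fun k => ?_⟩
  convert hcont k using 3
  ext α
  simp only [boundedPrefix, mem_ofPred_eq]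
  exact forall₂_congr fun i hi => by rw [hstab k i hi]

end TreeContent

/-! ### Compact boxes in Baire space -/

theorem isCompact_boundedSequences (n : ℕ → ℕ) : IsCompact {α : ℕ → ℕ | ∀ i, α i ≤ n i} := by
  have := isCompact_univ_pi (s := fun i => Set.Iic (n i)) fun i => (finite_Iic (n i)).isCompact
  convert this using 1
  ext α
  simp [Pi.le_def]

/-- Otherwise pick a counterexample for each `k` and set its terms from the `k`-th on to zero. The
truncated sequences lie in the compact box, and a limit of a subsequence of them is also a limit of
the original points outside `V`. -/
theorem exists_boundedPrefix_subset {n : ℕ → ℕ} {V : Set (ℕ → ℕ)} (hV : IsOpen V)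
    (h : {α : ℕ → ℕ | ∀ i, α i ≤ n i} ⊆ V) : ∃ k, boundedPrefix k n ⊆ V := by
  by_contra! hcon
  choose β hβ hβV using fun k => not_subset.1 (hcon k)
  let β' : ℕ → ℕ → ℕ := fun k i => if i < k then β k i else 0
  have hβ' : ∀ k, β' k ∈ {α : ℕ → ℕ | ∀ i, α i ≤ n i} := by
    intro k i
    simp only [β']
    split_ifs with hi
    · exact hβ k i hi
    · exact Nat.zero_le _
  obtain ⟨γ, hγ, φ, hφ, hlim⟩ := (isCompact_boundedSequences n).tendsto_subseq hβ'
  have hlim' : Tendsto (β ∘ φ) atTop (𝓝 γ) := by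
    rw [tendsto_pi_nhds] at hlim ⊢
    intro i
    refine (hlim i).congr' ?_
    filter_upwards [eventually_gt_atTop i] with k hk
    simp only [Function.comp, β']
    rw [if_pos (lt_of_lt_of_le hk (hφ.id_le k))]
  exact (hV.isClosed_compl.mem_of_tendsto hlim' (Eventually.of_forall fun k => hβV _)) (h hγ)

/-! ### Distribution of mass down a tree; measures dominated by the weights -/

section BranchMass

variable {Z : Type*}

/-- The masses obtained by distributing the mass of each node among its children in proportion to
the values of `g`. -/
noncomputable def branchMass (par : Z → Z) (g : ℕ → Z → ℝ≥0∞) : ℕ → Z → ℝ≥0∞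
  | 0, z => g 0 z
  | k + 1, z => branchMass par g k (par z) *
      (g (k + 1) z / ∑' y : {y // par y = par z}, g (k + 1) y)

variable {par : Z → Z} {g : ℕ → Z → ℝ≥0∞}

/-- Subadditivity of `g` means that a parent with mass at most `g` hands each child at most the
fraction 1 of its own value of `g`. -/
theorem branchMass_le (h : ∀ k z, g k z ≤ ∑' y : {y // par y = z}, g (k + 1) y) (k : ℕ) (z : Z) :
    branchMass par g k z ≤ g k z := by
  induction k generalizing z with
  | zero => exact le_rfl
  | succ k ih =>
    rw [branchMass, ← mul_div_assoc, mul_comm]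
    exact ENNReal.div_le_of_le_mul (by gcongr; exact (ih _).trans (h k _))

theorem tsum_branchMass_children (h : ∀ k z, g k z ≤ ∑' y : {y // par y = z}, g (k + 1) y)
    (hfin : ∀ k z, ∑' y : {y // par y = z}, g (k + 1) y ≠ ⊤) (k : ℕ) (z : Z) :
    ∑' y : {y // par y = z}, branchMass par g (k + 1) y = branchMass par g k z := by
  have : ∀ y : {y // par y = z}, branchMass par g (k + 1) y =
      (branchMass par g k z * (∑' y : {y // par y = z}, g (k + 1) y)⁻¹) * g (k + 1) y := by
    rintro ⟨y, rfl⟩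
    simp only [branchMass, div_eq_mul_inv]
    ring
  rw [tsum_congr this, ENNReal.tsum_mul_left, mul_assoc]
  by_cases h0 : ∑' y : {y // par y = z}, g (k + 1) y = 0
  · have : branchMass par g k z = 0 :=
      le_antisymm (((branchMass_le h k z).trans (h k z)).trans_eq h0) zero_le
    simp [this]
  · rw [ENNReal.inv_mul_cancel h0 (hfin k z), mul_one]

/-- Conservation of mass. With `φ` an indicator, the bounds known at level `j` carry over to the
discrete measures built at every deeper level. -/
theorem tsum_branchMass_mul (h : ∀ k z, g k z ≤ ∑' y : {y // par y = z}, g (k + 1) y)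
    (hfin : ∀ k z, ∑' y : {y // par y = z}, g (k + 1) y ≠ ⊤) (j i : ℕ) (φ : Z → ℝ≥0∞) :
    ∑' z, branchMass par g (j + i) z * φ (par^[i] z) = ∑' z, branchMass par g j z * φ z := by
  induction i generalizing φ with
  | zero => simp
  | succ i ih =>
    rw [← ih, ← (Equiv.sigmaFiberEquiv par).tsum_eq, ENNReal.tsum_sigma']
    refine tsum_congr fun z => ?_
    rw [← tsum_branchMass_children h hfin, ← ENNReal.tsum_mul_right]
    refine tsum_congr fun y => ?_
    rw [Equiv.sigmaFiberEquiv_apply, Function.iterate_succ_apply, y.2]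
    rfl

end BranchMass

/-- A compact set of positive content carries a probability measure that is bounded by the weights
of the nodes. -/
theorem exists_measure_le_treeWeight {X Z : Type*} [Countable Z] [MetricSpace X]
    [MeasurableSpace X] [BorelSpace X] {node : ℕ → X → Z} {w : ℕ → ℝ≥0∞} {par : Z → Z}
    (hpar : ∀ k x, par (node (k + 1) x) = node k x) {K : Set X} (hK : IsCompact K)
    (hfin : ∀ k, (node k '' K).Finite) (hw : ∀ k, w k ≠ ⊤) (hpos : treeContent node w K ≠ 0) :
    ∃ (μ : Measure X) (C : ℝ≥0∞), IsProbabilityMeasure μ ∧ μ Kᶜ = 0 ∧ C ≠ ⊤ ∧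
      ∀ (U : Set X) (j : ℕ) (N : Finset Z), IsOpen U → (∀ x ∈ U, node j x ∈ N) →
        μ U ≤ C * (N.card * w j) := by
  classical
  set g : ℕ → Z → ℝ≥0∞ := fun k z => treeContent node w (K ∩ {x | node k x = z}) with hg
  have hgw : ∀ k z, g k z ≤ w k := fun k z => treeContent_node_le K k z
  have hg0 : ∀ k z, z ∉ node k '' K → g k z = 0 := by
    intro k z hz
    have : K ∩ {x | node k x = z} = ∅ := by
      ext x
      simp only [mem_inter_iff, mem_ofPred_eq, mem_empty_iff_false, iff_false]
      rintro ⟨hx, rfl⟩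
      exact hz ⟨x, hx, rfl⟩
    simp only [hg, this, treeContent_empty]
  have hsum : ∀ k, ∑' z, g k z ≠ ⊤ := by
    intro k
    rw [tsum_eq_sum (s := (hfin k).toFinset) fun z hz => hg0 k z (by simpa using hz)]
    exact ENNReal.sum_ne_top.2 fun z _ => ne_top_of_le_ne_top (hw k) (hgw k z)
  have h1 : ∀ k z, g k z ≤ ∑' y : {y // par y = z}, g (k + 1) y := by
    intro k z
    refine le_trans (treeContent_mono ?_)
      (treeContent_iUnion_le fun y : {y // par y = z} => K ∩ {x | node (k + 1) x = y})
    rintro x ⟨hx, rfl⟩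
    exact mem_iUnion.2 ⟨⟨node (k + 1) x, hpar k x⟩, hx, rfl⟩
  have h2 : ∀ k z, ∑' y : {y // par y = z}, g (k + 1) y ≠ ⊤ := fun k z =>
    ne_top_of_le_ne_top (hsum (k + 1))
      (ENNReal.tsum_comp_le_tsum_of_injective Subtype.val_injective _)
  set m := branchMass par g with hm
  have hmg : ∀ k z, m k z ≤ g k z := branchMass_le h1
  set T := ∑' z, m 0 z with hT
  have hT0 : T ≠ 0 := by
    intro h
    refine hpos (le_antisymm ?_ zero_le)
    rw [← h]
    refine le_trans (treeContent_mono ?_)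
      (treeContent_iUnion_le fun z : Z => K ∩ {x | node 0 x = z})
    intro x hx
    exact mem_iUnion.2 ⟨node 0 x, hx, rfl⟩
  have hTtop : T ≠ ⊤ := hsum 0
  have hTk : ∀ k, ∑' z, m k z = T := by
    intro k
    have := tsum_branchMass_mul h1 h2 0 k 1
    simpa using this
  have hne : K.Nonempty := by
    rw [nonempty_iff_ne_empty]
    rintro rfl
    exact hpos treeContent_empty
  have : Nonempty K := hne.to_subtype
  have : CompactSpace K := isCompact_iff_compactSpace.1 hK
  -- The mass of each node is placed at a point of `K` inside it. Nodes that miss `K` have mass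
  -- zero, so their default point is irrelevant.
  let pt : ℕ → Z → K := fun k z =>
    if h : z ∈ node k '' K then ⟨h.choose, h.choose_spec.1⟩ else Classical.arbitrary K
  have hpt : ∀ k z, m k z ≠ 0 → node k (pt k z) = z := by
    intro k z hz
    have h : z ∈ node k '' K := by
      by_contra hcon
      exact hz (le_antisymm ((hmg k z).trans_eq (hg0 k z hcon)) zero_le)
    simp only [pt, dif_pos h]
    exact h.choose_spec.2
  let ν : ℕ → Measure K := fun k => T⁻¹ • Measure.sum fun z => m k z • Measure.dirac (pt k z)
  have hν : ∀ k, IsProbabilityMeasure (ν k) := by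
    intro k
    constructor
    simp only [ν, Measure.smul_apply, Measure.sum_apply _ MeasurableSet.univ, smul_eq_mul,
      measure_univ, mul_one, hTk, ENNReal.inv_mul_cancel hT0 hTtop]
  have hνU : ∀ (U : Set X) (j i : ℕ) (N : Finset Z), IsOpen U → (∀ x ∈ U, node j x ∈ N) →
      ν (j + i) (Subtype.val ⁻¹' U) ≤ T⁻¹ * (N.card * w j) := by
    intro U j i N hU hN
    have hUm : MeasurableSet (Subtype.val ⁻¹' U : Set K) := measurable_subtype_coe hU.measurableSet
    simp only [ν, Measure.smul_apply, Measure.sum_apply _ hUm, smul_eq_mul,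
      Measure.dirac_apply' _ hUm]
    gcongr
    have hanc : ∀ i x, par^[i] (node (j + i) x) = node j x := by
      intro i x
      induction i with
      | zero => rfl
      | succ i ih => rw [Function.iterate_succ_apply, ← add_assoc, hpar, ih]
    calc ∑' z, m (j + i) z * (Subtype.val ⁻¹' U : Set K).indicator 1 (pt (j + i) z)
        ≤ ∑' z, m (j + i) z * (N : Set Z).indicator 1 (par^[i] z) := by
          refine ENNReal.tsum_le_tsum fun z => ?_
          by_cases hz : m (j + i) z = 0
          · simp [hz]
          · gcongr
            by_cases hx : pt (j + i) z ∈ (Subtype.val ⁻¹' U : Set K)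
            · have : par^[i] z ∈ (N : Set Z) := by
                have := hN _ hx
                rwa [← hanc i, hpt _ _ hz] at this
              rw [indicator_of_mem hx, indicator_of_mem this]
              simp
            · rw [indicator_of_notMem hx]; exact zero_le
      _ = ∑' z, m j z * (N : Set Z).indicator 1 z := tsum_branchMass_mul h1 h2 j i _
      _ = ∑ z ∈ N, m j z := by
          rw [tsum_eq_sum (s := N) fun z hz => by simp [hz]]
          exact Finset.sum_congr rfl fun z hz => by simp [hz]
      _ ≤ ∑ z ∈ N, w j := Finset.sum_le_sum fun z _ => (hmg j z).trans (hgw j z)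
      _ = _ := by simp
  let νp : ℕ → ProbabilityMeasure K := fun k => ⟨ν k, hν k⟩
  -- A limit along an ultrafilter needs only compactness of the space of probability measures on
  -- `K`. Bounds on open sets survive weak limits.
  obtain ⟨μ, -, hμ⟩ := isCompact_univ.ultrafilter_le_nhds
    ((Filter.hyperfilter ℕ : Ultrafilter ℕ).map νp) (by simp)
  have hlim : Tendsto νp (Filter.hyperfilter ℕ : Filter ℕ) (𝓝 μ) := hμ
  refine ⟨(μ : Measure K).map Subtype.val, T⁻¹,
    Measure.isProbabilityMeasure_map measurable_subtype_coe.aemeasurable, ?_,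
    ENNReal.inv_ne_top.2 hT0, fun U j N hU hN => ?_⟩
  · rw [Measure.map_apply measurable_subtype_coe hK.isClosed.measurableSet.compl]
    simp
  · rw [Measure.map_apply measurable_subtype_coe hU.measurableSet]
    refine (ProbabilityMeasure.le_liminf_measure_open_of_tendsto hlim
      (hU.preimage continuous_subtype_val)).trans ?_
    refine liminf_le_of_frequently_le' (Eventually.frequently ?_)
    have : ∀ᶠ k in (Filter.hyperfilter ℕ : Filter ℕ), j ≤ k :=
      (Nat.hyperfilter_le_atTop) (eventually_ge_atTop j)
    filter_upwards [this] with k hk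
    obtain ⟨i, rfl⟩ := Nat.exists_eq_add_of_le hk
    exact hνU U j i N hU hN

/-! ### Dyadic cubes and Frostman's lemma -/

section Dyadic

variable {n : ℕ}

/-- The index of the dyadic cube of side `2⁻ᵏ` that contains `x`. -/
noncomputable def dyadicNode (k : ℕ) (x : EuclideanSpace ℝ (Fin n)) : Fin n → ℤ :=
  fun i => ⌊(2 : ℝ) ^ k * x i⌋

/-- The index of the dyadic cube of the previous level that contains a given cube. -/
def dyadicParent (z : Fin n → ℤ) : Fin n → ℤ := fun i => z i / 2

/-- The `s`-th power of the side of a dyadic cube of level `k`. -/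
noncomputable def dyadicWeight (s : ℝ) (k : ℕ) : ℝ≥0∞ := ((2 : ℝ≥0∞)⁻¹ ^ k) ^ s

theorem dyadicParent_dyadicNode (k : ℕ) (x : EuclideanSpace ℝ (Fin n)) :
    dyadicParent (dyadicNode (k + 1) x) = dyadicNode k x := by
  ext i
  simp only [dyadicParent, dyadicNode]
  set a := ⌊(2 : ℝ) ^ k * x i⌋ with ha
  have h1 : (a : ℝ) ≤ 2 ^ k * x i := Int.floor_le _
  have h2 : (2 : ℝ) ^ k * x i < a + 1 := Int.lt_floor_add_one _
  have h3 : 2 * a ≤ ⌊(2 : ℝ) ^ (k + 1) * x i⌋ := by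
    rw [Int.le_floor]; push_cast; rw [pow_succ]; linarith
  have h4 : ⌊(2 : ℝ) ^ (k + 1) * x i⌋ < 2 * a + 2 := by
    rw [Int.floor_lt]; push_cast; rw [pow_succ]; linarith
  omega

theorem treeRefines_dyadicNode : TreeRefines (dyadicNode (n := n)) := by
  intro k l x y hkl h
  induction l, hkl using Nat.le_induction with
  | base => exact h
  | succ l _ ih =>
    exact ih (by rw [← dyadicParent_dyadicNode, h, dyadicParent_dyadicNode])

theorem dyadicWeight_ne_top {s : ℝ} (hs : 0 ≤ s) (k : ℕ) : dyadicWeight s k ≠ ⊤ :=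
  ENNReal.rpow_ne_top_of_nonneg hs (by simp)

theorem dyadicWeight_ne_zero (s : ℝ) (k : ℕ) : dyadicWeight s k ≠ 0 := by
  unfold dyadicWeight
  simp [ENNReal.rpow_eq_zero_iff]

theorem dyadicWeight_antitone {s : ℝ} (hs : 0 ≤ s) : Antitone (dyadicWeight s) := fun k l hkl =>
  ENNReal.rpow_le_rpow (pow_le_pow_of_le_one zero_le (by simp) hkl) hs

theorem tendsto_dyadicWeight {s : ℝ} (hs : 0 < s) :
    Tendsto (dyadicWeight s) atTop (𝓝 0) := by
  have h1 : Tendsto (fun k : ℕ => (2 : ℝ≥0∞)⁻¹ ^ k) atTop (𝓝 0) :=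
    ENNReal.tendsto_pow_atTop_nhds_zero_of_lt_one (by simp)
  have := (ENNReal.continuous_rpow_const (y := s)).tendsto 0 |>.comp h1
  rw [ENNReal.zero_rpow_of_pos hs] at this
  exact this

theorem exists_ediam_dyadicCube_le (n : ℕ) : ∃ c : ℝ≥0, ∀ (k : ℕ) (z : Fin n → ℤ),
    Metric.ediam {x : EuclideanSpace ℝ (Fin n) | dyadicNode k x = z} ≤ c * 2⁻¹ ^ k := by
  obtain ⟨c, hanti⟩ : ∃ c, AntilipschitzWith c (WithLp.ofLp : EuclideanSpace ℝ (Fin n) → _) :=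
    ⟨_, PiLp.antilipschitzWith_ofLp 2 (fun _ : Fin n => ℝ)⟩
  refine ⟨c, fun k z => Metric.ediam_le fun x hx y hy => (hanti x y).trans ?_⟩
  gcongr
  rw [edist_pi_le_iff]
  intro i
  have hx' : ⌊(2 : ℝ) ^ k * x i⌋ = z i := congrFun hx i
  have hy' : ⌊(2 : ℝ) ^ k * y i⌋ = z i := congrFun hy i
  have h := Int.abs_sub_lt_one_of_floor_eq_floor (hx'.trans hy'.symm)
  rw [← mul_sub, abs_mul, abs_of_pos (by positivity)] at h
  rw [edist_dist, Real.dist_eq]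
  have h2 : (2 : ℝ≥0∞)⁻¹ ^ k = ENNReal.ofReal ((2 : ℝ)⁻¹ ^ k) := by
    rw [ENNReal.ofReal_pow (by norm_num), ENNReal.ofReal_inv_of_pos (by norm_num)]
    norm_num
  rw [h2]
  apply ENNReal.ofReal_le_ofReal
  rw [inv_pow, ← one_div, le_div_iff₀ (by positivity), mul_comm]
  exact h.le

/-- A cover cheaper than one cube of level `N` uses only cubes of level at least `N`. Zero content
thus produces arbitrarily fine covers of arbitrarily small cost, which forces `μH[s] S = 0`. -/
theorem dyadicContent_ne_zero {s : ℝ} (hs : 0 < s) {S : Set (EuclideanSpace ℝ (Fin n))}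
    (hS : μH[s] S ≠ 0) : treeContent dyadicNode (dyadicWeight s) S ≠ 0 := by
  intro h0
  obtain ⟨c, hc⟩ := exists_ediam_dyadicCube_le n
  have hex : ∀ N : ℕ, ∃ C : Set (ℕ × (Fin n → ℤ)), TreeCovers dyadicNode C S ∧
      treeCost (dyadicWeight s) C < dyadicWeight s N := fun N =>
    exists_treeCovers_lt (by rw [h0]; exact pos_iff_ne_zero.2 (dyadicWeight_ne_zero s N))
  choose C hC hCc using hex
  have hlev : ∀ N, ∀ p ∈ C N, N ≤ p.1 := by
    intro N p hp
    by_contra! hlt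
    refine absurd (hCc N) (not_lt.2 ((dyadicWeight_antitone hs.le hlt.le).trans ?_))
    calc dyadicWeight s p.1 = (C N).indicator (fun p => dyadicWeight s p.1) p := by
          rw [indicator_of_mem hp]
      _ ≤ _ := ENNReal.le_tsum p
  apply hS
  have hrlim : Tendsto (fun N : ℕ => (c : ℝ≥0∞) * 2⁻¹ ^ N) atTop (𝓝 0) := by
    have := ENNReal.Tendsto.const_mul (a := (c : ℝ≥0∞))
      (ENNReal.tendsto_pow_atTop_nhds_zero_of_lt_one (r := (2 : ℝ≥0∞)⁻¹) (by simp))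
      (Or.inr ENNReal.coe_ne_top)
    simpa using this
  have key := Measure.hausdorffMeasure_le_liminf_tsum (β := ℕ) (ι := fun N => ↥(C N)) s S
    (l := atTop) (fun N => (c : ℝ≥0∞) * 2⁻¹ ^ N) hrlim
    (fun N p => {x | dyadicNode p.1.1 x = p.1.2})
    (Eventually.of_forall fun N p => (hc _ _).trans (by
      exact mul_le_mul_right (pow_le_pow_of_le_one zero_le (ENNReal.inv_le_one.2 one_le_two)
        (hlev N p.1 p.2)) _))
    (Eventually.of_forall fun N x hx => by
      obtain ⟨k, hk⟩ := hC N x hx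
      exact mem_iUnion.2 ⟨⟨_, hk⟩, rfl⟩)
  refine le_antisymm (key.trans ?_) zero_le
  have hle : ∀ N, ∑' p : C N, Metric.ediam {x : EuclideanSpace ℝ (Fin n) |
      dyadicNode p.1.1 x = p.1.2} ^ s ≤ (c : ℝ≥0∞) ^ s * dyadicWeight s N := by
    intro N
    calc _ ≤ ∑' p : C N, (c : ℝ≥0∞) ^ s * dyadicWeight s p.1.1 := by
          refine ENNReal.tsum_le_tsum fun p => ?_
          rw [dyadicWeight, ← ENNReal.mul_rpow_of_nonneg _ _ hs.le]
          exact ENNReal.rpow_le_rpow (hc _ _) hs.le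
      _ = (c : ℝ≥0∞) ^ s * treeCost (dyadicWeight s) (C N) := by
          rw [ENNReal.tsum_mul_left, treeCost,
            tsum_subtype (C N) fun p => dyadicWeight s p.1]
      _ ≤ _ := by gcongr; exact (hCc N).le
  have hlim : Tendsto (fun N => (c : ℝ≥0∞) ^ s * dyadicWeight s N) atTop (𝓝 0) := by
    have := ENNReal.Tendsto.const_mul (a := (c : ℝ≥0∞) ^ s) (tendsto_dyadicWeight hs)
      (Or.inr (ENNReal.rpow_ne_top_of_nonneg hs.le ENNReal.coe_ne_top))
    simpa using this
  exact (liminf_le_liminf (Eventually.of_forall hle)).trans hlim.liminf_eq.le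

/-- The offsets of the dyadic cubes that touch a given one. -/
noncomputable def neighborOffsets (n : ℕ) : Finset (Fin n → ℤ) :=
  Fintype.piFinset fun _ => Finset.Icc (-1) 1

theorem card_neighborOffsets (n : ℕ) : (neighborOffsets n).card = 3 ^ n := by
  simp [neighborOffsets, Fintype.card_piFinset]

theorem sub_mem_neighborOffsets {k : ℕ} {x : EuclideanSpace ℝ (Fin n)} {z : Fin n → ℤ}
    (h : ∀ i, (z i - 1 : ℝ) < 2 ^ k * x i ∧ 2 ^ k * x i < z i + 2) :
    dyadicNode k x - z ∈ neighborOffsets n := by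
  simp only [neighborOffsets, Fintype.mem_piFinset, Finset.mem_Icc, Pi.sub_apply, dyadicNode]
  intro i
  have h1 : z i - 1 ≤ ⌊(2 : ℝ) ^ k * x i⌋ := by
    rw [Int.le_floor]; push_cast; exact (h i).1.le
  have h2 : ⌊(2 : ℝ) ^ k * x i⌋ < z i + 2 := by
    rw [Int.floor_lt]; push_cast; exact (h i).2
  omega

/-- Write `A` as a continuous image of Baire space and take the image of the box given by
capacitability. If that compact image had a very cheap cover, the slightly enlarged cubes would form
an open set containing the image of some `boundedPrefix`, whose content exceeds `a`. -/
theorem exists_isCompact_dyadicContent_ne_zero {A : Set (EuclideanSpace ℝ (Fin n))}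
    (hA : MeasurableSet A) {w : ℕ → ℝ≥0∞} (h : treeContent dyadicNode w A ≠ 0) :
    ∃ K ⊆ A, IsCompact K ∧ treeContent dyadicNode w K ≠ 0 := by
  have han := hA.analyticSet
  rw [AnalyticSet] at han
  rcases han with rfl | ⟨g, hg, rfl⟩
  · exact absurd treeContent_empty h
  obtain ⟨a, ha0, ha⟩ := exists_between (pos_iff_ne_zero.2 h)
  obtain ⟨b, hb⟩ := exists_bounds_treeContent treeRefines_dyadicNode g ha
  refine ⟨g '' {α | ∀ i, α i ≤ b i}, image_subset_range _ _,
    (isCompact_boundedSequences b).image hg, fun hK => ?_⟩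
  -- An enlarged cube is covered by the cube and its neighbours, so the enlargement multiplies the
  -- cost by at most `3 ^ n`.
  have ha' : 0 < a / 3 ^ n := ENNReal.div_pos ha0.ne' (by simp)
  obtain ⟨C, hC, hCc⟩ := exists_treeCovers_lt (hK.trans_lt ha')
  let U : Set (EuclideanSpace ℝ (Fin n)) := ⋃ p ∈ C, {x | ∀ i, ((p.2 i : ℝ) - 1) < 2 ^ p.1 * x i ∧
    2 ^ p.1 * x i < (p.2 i : ℝ) + 2}
  have hU : IsOpen U := by
    refine isOpen_biUnion fun p _ => ?_
    rw [ofPred_forall]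
    refine isOpen_iInter_of_finite fun i => ?_
    have hc : Continuous fun x : EuclideanSpace ℝ (Fin n) => (2 : ℝ) ^ p.1 * x i := by fun_prop
    exact (isOpen_lt continuous_const hc).inter (isOpen_lt hc continuous_const)
  have hKU : g '' {α | ∀ i, α i ≤ b i} ⊆ U := by
    intro x hx
    obtain ⟨k, hk⟩ := hC x hx
    refine mem_biUnion hk fun i => ⟨?_, ?_⟩
    · have := Int.floor_le ((2 : ℝ) ^ k * x i)
      simp only [dyadicNode]; linarith
    · have := Int.lt_floor_add_one ((2 : ℝ) ^ k * x i)
      simp only [dyadicNode]; linarith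
  obtain ⟨k, hk⟩ := exists_boundedPrefix_subset (hU.preimage hg) (image_subset_iff.1 hKU)
  refine absurd ((hb k).trans_le (treeContent_mono (image_subset_iff.2 hk))) (not_lt.2 ?_)
  let D : neighborOffsets n → Set (ℕ × (Fin n → ℤ)) := fun e => {p | (p.1, p.2 - e.1) ∈ C}
  have hD : ∀ e, treeCost w (D e) = treeCost w C := by
    intro e
    unfold treeCost
    rw [← ((Equiv.refl ℕ).prodCongr (Equiv.addRight e.1)).tsum_eq]
    refine tsum_congr fun p => ?_
    have : ((Equiv.refl ℕ).prodCongr (Equiv.addRight e.1)) p ∈ D e ↔ p ∈ C := by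
      simp [D, Equiv.prodCongr_apply]
    by_cases hp : p ∈ C
    · rw [indicator_of_mem (this.2 hp), indicator_of_mem hp]
      rfl
    · rw [indicator_of_notMem (mt this.1 hp), indicator_of_notMem hp]
  have hcov : TreeCovers dyadicNode (⋃ e, D e) U := by
    intro x hx
    obtain ⟨p, hp, hx⟩ := mem_iUnion₂.1 hx
    refine ⟨p.1, mem_iUnion.2 ⟨⟨_, sub_mem_neighborOffsets hx⟩, ?_⟩⟩
    simpa [D] using hp
  calc treeContent dyadicNode w U ≤ treeCost w (⋃ e, D e) := treeContent_le hcov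
    _ ≤ ∑' e, treeCost w (D e) := treeCost_iUnion_le D
    _ = 3 ^ n * treeCost w C := by
        simp [hD, tsum_fintype, card_neighborOffsets]
    _ ≤ 3 ^ n * (a / 3 ^ n) := by gcongr
    _ ≤ a := ENNReal.mul_div_le

/-- **Frostman's lemma** for Borel sets. -/
theorem exists_frostman_measure {A : Set (EuclideanSpace ℝ (Fin n))} (hA : MeasurableSet A)
    {s : ℝ} (hs : 0 < s) (h : μH[s] A ≠ 0) :
    ∃ (K : Set (EuclideanSpace ℝ (Fin n))) (μ : Measure (EuclideanSpace ℝ (Fin n))) (C : ℝ≥0∞),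
      K ⊆ A ∧ IsCompact K ∧ IsProbabilityMeasure μ ∧ μ Kᶜ = 0 ∧ C ≠ ⊤ ∧
      ∀ x (j : ℕ), μ (Metric.ball x (2⁻¹ ^ j)) ≤ C * dyadicWeight s j := by
  classical
  obtain ⟨K, hKA, hK, hpos⟩ := exists_isCompact_dyadicContent_ne_zero hA
    (dyadicContent_ne_zero hs h)
  have hfin : ∀ k, (dyadicNode k '' K).Finite := by
    intro k
    obtain ⟨R, hR⟩ := hK.isBounded.exists_norm_le
    refine (Fintype.piFinset fun _ : Fin n => Finset.Icc ⌊(2 : ℝ) ^ k * (-R)⌋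
      ⌊(2 : ℝ) ^ k * R⌋).finite_toSet.subset ?_
    rintro _ ⟨x, hx, rfl⟩
    simp only [Finset.mem_coe, Fintype.mem_piFinset, Finset.mem_Icc, dyadicNode]
    intro i
    have h1 : |x i| ≤ R := (PiLp.norm_apply_le x i).trans (hR x hx)
    rw [abs_le] at h1
    exact ⟨Int.floor_le_floor (by gcongr; exact h1.1), Int.floor_le_floor (by gcongr; exact h1.2)⟩
  obtain ⟨μ, C, hμ, hμK, hC, hμU⟩ := exists_measure_le_treeWeight dyadicParent_dyadicNode hK hfin
    (dyadicWeight_ne_top hs.le) hpos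
  refine ⟨K, μ, C * 3 ^ n, hKA, hK, hμ, hμK, ENNReal.mul_ne_top hC (by simp), fun x j => ?_⟩
  -- A ball of radius `2⁻ʲ` meets only the cube of level `j` containing its centre and the
  -- neighbours of that cube.
  refine (hμU _ j ((neighborOffsets n).image (dyadicNode j x + ·)) Metric.isOpen_ball
    fun y hy => ?_).trans ?_
  · refine Finset.mem_image.2 ⟨dyadicNode j y - dyadicNode j x,
      sub_mem_neighborOffsets fun i => ?_, by abel⟩
    have h1 : |y i - x i| < 2⁻¹ ^ j := by
      have := (PiLp.norm_apply_le (y - x) i).trans_lt (mem_ball_iff_norm.1 hy)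
      simpa using this
    rw [inv_pow, ← one_div, lt_div_iff₀ (by positivity), mul_comm, ← abs_of_pos
      (show (0 : ℝ) < 2 ^ j by positivity), ← abs_mul, mul_sub, abs_lt] at h1
    have h2 := Int.floor_le ((2 : ℝ) ^ j * x i)
    have h3 := Int.lt_floor_add_one ((2 : ℝ) ^ j * x i)
    simp only [dyadicNode]
    constructor <;> linarith
  · rw [mul_assoc]
    gcongr
    calc (((neighborOffsets n).image (dyadicNode j x + ·)).card : ℝ≥0∞)
        ≤ ((neighborOffsets n).card : ℕ) := by exact_mod_cast Finset.card_image_le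
      _ = 3 ^ n := by rw [card_neighborOffsets]; norm_num

end Dyadic

/-! ### Projections along non-horizontal directions -/

section Slant

variable {m : ℕ}

/-- The projection along the direction `(v, 1)` to the first `m` coordinates. -/
noncomputable def slantProj (v : Fin m → ℝ) (x : EuclideanSpace ℝ (Fin (m + 1))) : Fin m → ℝ :=
  fun i => x i.castSucc - x (Fin.last m) * v i

theorem slantProj_sub (v : Fin m → ℝ) (x y : EuclideanSpace ℝ (Fin (m + 1))) :
    slantProj v (x - y) = slantProj v x - slantProj v y := by
  ext i
  simp only [slantProj, PiLp.sub_apply, Pi.sub_apply]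
  ring

theorem continuous_slantProj_uncurry :
    Continuous fun p : (Fin m → ℝ) × EuclideanSpace ℝ (Fin (m + 1)) => slantProj p.1 p.2 := by
  unfold slantProj
  fun_prop

theorem continuous_slantProj (v : Fin m → ℝ) : Continuous (slantProj v) := by
  unfold slantProj
  fun_prop

theorem norm_le_sum_abs {n : ℕ} (z : EuclideanSpace ℝ (Fin n)) : ‖z‖ ≤ ∑ i, |z i| := by
  have h := (EuclideanSpace.basisFun (Fin n) ℝ).sum_repr z
  calc ‖z‖ = ‖∑ i, z i • EuclideanSpace.basisFun (Fin n) ℝ i‖ := by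
        conv_lhs => rw [← h]
        simp
    _ ≤ ∑ i, ‖z i • EuclideanSpace.basisFun (Fin n) ℝ i‖ := norm_sum_le _ _
    _ = _ := by simp [norm_smul]

/-- If the last coordinate `t` of `z` is comparable to `‖z‖`, the condition confines `v` to a cube
of side `2δ/|t|`. If `t` is smaller and some `v` qualifies, every coordinate of `z` is at most `δ +
|t|`, hence `‖z‖ ≤ 2(m + 1)δ`, and the bound exceeds the volume `2 ^ m` of the whole cube. -/
theorem volume_slantProj_le {z : EuclideanSpace ℝ (Fin (m + 1))} (hz : z ≠ 0) {δ : ℝ}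
    (hδ : 0 ≤ δ) :
    volume ({v : Fin m → ℝ | ‖slantProj v z‖ ≤ δ} ∩ Icc (-1) 1) ≤
      ENNReal.ofReal (4 * (m + 1) * δ / ‖z‖) ^ m := by
  have hz0 : 0 < ‖z‖ := norm_pos_iff.2 hz
  set t := z (Fin.last m) with ht
  have hm : (0 : ℝ) < m + 1 := by positivity
  by_cases hcase : ‖z‖ / (2 * (m + 1)) ≤ |t|
  · have ht0 : 0 < |t| := lt_of_lt_of_le (by positivity) hcase
    have hsub : {v : Fin m → ℝ | ‖slantProj v z‖ ≤ δ} ∩ Icc (-1) 1 ⊆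
        Set.pi univ fun i => Metric.closedBall (z i.castSucc / t) (δ / |t|) := by
      rintro v ⟨hv, -⟩ i -
      have := (norm_le_pi_norm (slantProj v z) i).trans hv
      rw [mem_closedBall_iff_norm, le_div_iff₀ ht0, Real.norm_eq_abs, ← abs_mul]
      have ht' : t ≠ 0 := abs_pos.1 ht0
      have e : (v i - z i.castSucc / t) * t = -(slantProj v z i) := by
        simp only [slantProj]; field_simp; rw [← ht]; ring
      rw [e, abs_neg]; exact this
    refine (measure_mono hsub).trans ?_
    rw [volume_pi_pi]
    simp only [Real.volume_closedBall, Finset.prod_const, Finset.card_univ, Fintype.card_fin]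
    gcongr
    rw [mul_div_assoc', div_le_div_iff₀ ht0 hz0]
    rw [div_le_iff₀ (by positivity)] at hcase
    nlinarith
  · push Not at hcase
    rcases eq_empty_or_nonempty ({v : Fin m → ℝ | ‖slantProj v z‖ ≤ δ} ∩ Icc (-1) 1) with h | h
    · rw [h]; simp
    obtain ⟨v, hv, hv1⟩ := h
    have hzi : ∀ i, |z i| ≤ δ + |t| := by
      intro i
      refine Fin.lastCases ?_ (fun i => ?_) i
      · linarith
      · have h1 := (norm_le_pi_norm (slantProj v z) i).trans hv
        have h2 : |v i| ≤ 1 := abs_le.2 ⟨hv1.1 i, hv1.2 i⟩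
        have e : z i.castSucc = slantProj v z i + t * v i := by simp [slantProj, ht]
        rw [e]
        refine (abs_add_le _ _).trans (add_le_add h1 ?_)
        rw [abs_mul]
        exact mul_le_of_le_one_right (abs_nonneg _) h2
    have hsum : ‖z‖ ≤ (m + 1) * (δ + |t|) := by
      refine (norm_le_sum_abs z).trans ((Finset.sum_le_sum fun i _ => hzi i).trans_eq ?_)
      simp
      ring
    refine (measure_mono inter_subset_right).trans ?_
    rw [Real.volume_Icc_pi]
    simp only [Pi.one_apply, Pi.neg_apply, Finset.prod_const, Finset.card_univ, Fintype.card_fin]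
    gcongr
    rw [le_div_iff₀ hz0]
    rw [lt_div_iff₀ (by positivity)] at hcase
    nlinarith

theorem eq_of_slantProj_eq {v : Fin m → ℝ} {x y : EuclideanSpace ℝ (Fin (m + 1))}
    (h : slantProj v x = slantProj v y) (hl : x (Fin.last m) = y (Fin.last m)) : x = y := by
  ext i
  refine Fin.lastCases hl (fun i => ?_) i
  have := congrFun h i
  simp only [slantProj, hl] at this
  linarith

theorem collinear_of_slantProj_eq {v : Fin m → ℝ} {S : Set (EuclideanSpace ℝ (Fin (m + 1)))}
    (h : ∀ x ∈ S, ∀ y ∈ S, slantProj v x = slantProj v y) : Collinear ℝ S := by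
  rcases S.eq_empty_or_nonempty with rfl | ⟨x, hx⟩
  · exact collinear_empty ℝ _
  rw [collinear_iff_of_mem hx]
  refine ⟨WithLp.toLp 2 (Fin.snoc v 1), fun y hy => ⟨y (Fin.last m) - x (Fin.last m), ?_⟩⟩
  ext i
  refine Fin.lastCases ?_ (fun i => ?_) i
  · simp
  · have := congrFun (h x hx y hy) i
    simp only [slantProj] at this
    simp
    linarith

/-- The points of `K` that have another point of `K` above them on the same line. -/
def lowerPart (v : Fin m → ℝ) (K : Set (EuclideanSpace ℝ (Fin (m + 1)))) :
    Set (EuclideanSpace ℝ (Fin (m + 1))) :=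
  {x ∈ K | ∃ y ∈ K, slantProj v y = slantProj v x ∧ x (Fin.last m) < y (Fin.last m)}

/-- Requiring a gap of at least `1/(k + 1)` makes the condition closed, so the set is a countable
union of projections of compact sets. -/
theorem measurableSet_lowerPart (v : Fin m → ℝ) {K : Set (EuclideanSpace ℝ (Fin (m + 1)))}
    (hK : IsCompact K) : MeasurableSet (lowerPart v K) := by
  have : lowerPart v K = ⋃ k : ℕ, Prod.fst '' ((K ×ˢ K) ∩ {p | slantProj v p.2 = slantProj v p.1 ∧
      p.1 (Fin.last m) + 1 / ((k : ℝ) + 1) ≤ p.2 (Fin.last m)}) := by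
    ext x
    simp only [lowerPart, mem_ofPred_eq, mem_iUnion, mem_image, mem_inter_iff, mem_prod,
      Prod.exists, exists_and_right, exists_eq_right]
    constructor
    · rintro ⟨hx, y, hy, h1, h2⟩
      obtain ⟨k, hk⟩ := exists_nat_one_div_lt (sub_pos.2 h2)
      exact ⟨k, y, ⟨hx, hy⟩, h1, by linarith⟩
    · rintro ⟨k, y, ⟨hx, hy⟩, h1, h2⟩
      have : 0 < 1 / ((k : ℝ) + 1) := by positivity
      exact ⟨hx, y, hy, h1, by linarith⟩
  rw [this]
  refine MeasurableSet.iUnion fun k => IsCompact.measurableSet ?_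
  refine ((hK.prod hK).inter_right ?_).image continuous_fst
  have hcl : IsClosed {p : EuclideanSpace ℝ (Fin (m + 1)) × EuclideanSpace ℝ (Fin (m + 1)) |
      p.1 (Fin.last m) + 1 / ((k : ℝ) + 1) ≤ p.2 (Fin.last m)} :=
    isClosed_le (by fun_prop) (by fun_prop)
  exact (isClosed_eq ((continuous_slantProj v).comp continuous_snd)
    ((continuous_slantProj v).comp continuous_fst)).inter hcl

theorem injOn_slantProj_diff_lowerPart (v : Fin m → ℝ)
    (K : Set (EuclideanSpace ℝ (Fin (m + 1)))) : InjOn (slantProj v) (K \ lowerPart v K) := by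
  intro x hx y hy hxy
  rcases lt_trichotomy (x (Fin.last m)) (y (Fin.last m)) with h | h | h
  · exact absurd ⟨hx.1, y, hy.1, hxy.symm, h⟩ hx.2
  · exact eq_of_slantProj_eq hxy h
  · exact absurd ⟨hy.1, x, hx.1, hxy, h⟩ hy.2

/-- Given two points of the lower part on one line, the upper one has a third point of `K` above it.
-/
theorem injOn_slantProj_lowerPart (v : Fin m → ℝ) {K : Set (EuclideanSpace ℝ (Fin (m + 1)))}
    (hK : NoThreeCollinear K) : InjOn (slantProj v) (lowerPart v K) := by
  have key : ∀ x ∈ lowerPart v K, ∀ y ∈ lowerPart v K, slantProj v x = slantProj v y →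
      ¬ x (Fin.last m) < y (Fin.last m) := by
    rintro x ⟨hx, -⟩ y ⟨hy, z, hz, hzy, hlt⟩ hxy h
    refine hK x hx y hy z hz (fun e => by simp [e] at h) (fun e => by simp [e] at hlt)
      (fun e => by rw [e] at h; exact lt_asymm h hlt) (collinear_of_slantProj_eq (v := v) ?_)
    have : ∀ a ∈ ({x, y, z} : Set _), slantProj v a = slantProj v y := by
      rintro a (rfl | rfl | rfl)
      exacts [hxy, rfl, hzy]
    intro a ha b hb
    rw [this a ha, this b hb]
  intro x hx y hy hxy
  rcases lt_trichotomy (x (Fin.last m)) (y (Fin.last m)) with h | h | h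
  · exact absurd h (key x hx y hy hxy)
  · exact eq_of_slantProj_eq hxy h
  · exact absurd h (key y hy x hx hxy.symm)

/-- One of the two pieces has mass at least `1/2`; the value `1/4` leaves room for inner
approximation by a compact set. -/
theorem exists_isCompact_injOn_slantProj (v : Fin m → ℝ)
    {K : Set (EuclideanSpace ℝ (Fin (m + 1)))} (hK : IsCompact K) (hK3 : NoThreeCollinear K)
    (μ : Measure (EuclideanSpace ℝ (Fin (m + 1)))) [IsProbabilityMeasure μ] (hμ : μ Kᶜ = 0) :
    ∃ K' ⊆ K, IsCompact K' ∧ InjOn (slantProj v) K' ∧ 4⁻¹ ≤ μ K' := by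
  have hm := measurableSet_lowerPart v hK
  have h1 : 1 ≤ μ (lowerPart v K) + μ (K \ lowerPart v K) := by
    have : μ K = 1 := (prob_compl_eq_zero_iff hK.measurableSet).1 hμ
    rw [← this]
    refine (measure_mono ?_).trans (measure_union_le _ _)
    intro x hx
    by_cases h : x ∈ lowerPart v K
    exacts [Or.inl h, Or.inr ⟨hx, h⟩]
  have h2 : ∃ P ⊆ K, MeasurableSet P ∧ InjOn (slantProj v) P ∧ 4⁻¹ < μ P := by
    by_contra! hcon
    have ha := hcon _ (fun x hx => hx.1) hm (injOn_slantProj_lowerPart v hK3)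
    have hb := hcon _ sdiff_subset (hK.measurableSet.diff hm) (injOn_slantProj_diff_lowerPart v K)
    have : (1 : ℝ≥0∞) ≤ 4⁻¹ + 4⁻¹ := h1.trans (add_le_add ha hb)
    have h3 := ENNReal.toReal_mono (by simp) this
    rw [ENNReal.toReal_add (by simp) (by simp)] at h3
    norm_num at h3
  obtain ⟨P, hPK, hP, hinj, hlt⟩ := h2
  obtain ⟨K', hK'P, hK', hlt'⟩ := hP.exists_lt_isCompact hlt
  exact ⟨K', hK'P.trans hPK, hK', hinj.mono hK'P, hlt'.le⟩

/-- The pairs in `K` at distance at least `r` form a compact set on which the distance of the images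
is positive, hence bounded below. -/
theorem exists_dist_lt_of_injOn {X Y : Type*} [MetricSpace X] [MetricSpace Y] {f : X → Y}
    (hf : Continuous f) {K : Set X} (hK : IsCompact K) (hinj : InjOn f K) {r : ℝ} (hr : 0 < r) :
    ∃ δ > 0, ∀ x ∈ K, ∀ y ∈ K, dist (f x) (f y) < δ → dist x y < r := by
  have hc : IsCompact ((K ×ˢ K) ∩ {p | r ≤ dist p.1 p.2}) :=
    (hK.prod hK).inter_right (isClosed_le continuous_const continuous_dist)
  rcases eq_empty_or_nonempty ((K ×ˢ K) ∩ {p | r ≤ dist p.1 p.2}) with h | h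
  · refine ⟨1, one_pos, fun x hx y hy _ => ?_⟩
    by_contra! hcon
    have hmem : (x, y) ∈ (K ×ˢ K) ∩ {p | r ≤ dist p.1 p.2} := ⟨⟨hx, hy⟩, hcon⟩
    rw [h] at hmem
    exact hmem
  · obtain ⟨p, ⟨hpK, hp⟩, hmin⟩ := hc.exists_isMinOn h
      (f := fun p => dist (f p.1) (f p.2)) (by fun_prop)
    refine ⟨dist (f p.1) (f p.2), ?_, fun x hx y hy hxy => ?_⟩
    · refine dist_pos.2 fun e => ?_
      have e' := hinj hpK.1 hpK.2 e
      have : r ≤ 0 := by simpa [e'] using hp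
      linarith
    · by_contra! hcon
      exact absurd (hmin (⟨⟨hx, hy⟩, hcon⟩ : (x, y) ∈ (K ×ˢ K) ∩ {p | r ≤ dist p.1 p.2}))
        (not_le.2 hxy)

/-- Pairs at distance less than `r` whose projections are at distance at most `δ`. -/
def closePairs (r δ : ℝ) : Set ((Fin m → ℝ) ×
    (EuclideanSpace ℝ (Fin (m + 1)) × EuclideanSpace ℝ (Fin (m + 1)))) :=
  {p | dist p.2.1 p.2.2 < r ∧ ‖slantProj p.1 (p.2.1 - p.2.2)‖ ≤ δ}

theorem measurableSet_closePairs (r δ : ℝ) : MeasurableSet (closePairs (m := m) r δ) := by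
  refine MeasurableSet.inter (IsOpen.measurableSet ?_) (IsClosed.measurableSet ?_)
  · exact isOpen_lt (f := fun p : (Fin m → ℝ) × (EuclideanSpace ℝ (Fin (m + 1)) ×
      EuclideanSpace ℝ (Fin (m + 1))) => dist p.2.1 p.2.2) (by fun_prop) continuous_const
  · exact isClosed_le (continuous_norm.comp (continuous_slantProj_uncurry.comp
      (by fun_prop : Continuous fun p : (Fin m → ℝ) × (EuclideanSpace ℝ (Fin (m + 1)) ×
        EuclideanSpace ℝ (Fin (m + 1))) => (p.1, p.2.1 - p.2.2)))) continuous_const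

/-- A probability measure on `N` cells gives measure at least `1 / N` to the pairs of points in a
common cell. -/
theorem sq_measure_le_card_mul {X ι : Type*} [MeasurableSpace X] [MeasurableSpace ι]
    [MeasurableSingletonClass ι] (μ : Measure X) [IsFiniteMeasure μ] {a : X → ι}
    (ha : Measurable a) {P : Set X} (hP : MeasurableSet P) (N : Finset ι) (hN : ∀ x ∈ P, a x ∈ N) :
    μ P ^ 2 ≤ N.card * (μ.prod μ) {p | p.1 ∈ P ∧ p.2 ∈ P ∧ a p.1 = a p.2} := by
  have hcell : ∀ z, MeasurableSet (P ∩ a ⁻¹' {z}) := fun z =>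
    hP.inter (ha (measurableSet_singleton z))
  have hdis : ∀ s : Set (ι), s.PairwiseDisjoint fun z => P ∩ a ⁻¹' {z} := by
    intro s z _ z' _ hne
    refine disjoint_left.2 ?_
    rintro x ⟨-, rfl⟩ ⟨-, h⟩
    exact hne h
  have h1 : μ P = ∑ z ∈ N, μ (P ∩ a ⁻¹' {z}) := by
    rw [← measure_biUnion_finset (hdis _) fun z _ => hcell z]
    congr 1
    ext x
    simp only [mem_iUnion, mem_inter_iff, mem_preimage, mem_singleton_iff, exists_prop]
    exact ⟨fun hx => ⟨a x, hN x hx, hx, rfl⟩, fun ⟨_, _, hx, _⟩ => hx⟩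
  have h2 : ∑ z ∈ N, μ (P ∩ a ⁻¹' {z}) ^ 2 ≤
      (μ.prod μ) {p | p.1 ∈ P ∧ p.2 ∈ P ∧ a p.1 = a p.2} := by
    simp_rw [sq, ← Measure.prod_prod]
    rw [← measure_biUnion_finset]
    · refine measure_mono (iUnion₂_subset fun z _ => ?_)
      rintro ⟨x, y⟩ ⟨⟨hx, hx'⟩, hy, hy'⟩
      exact ⟨hx, hy, hx'.trans hy'.symm⟩
    · intro z hz z' hz' hne
      exact Disjoint.set_prod_left (hdis univ (mem_univ _) (mem_univ _) hne) _ _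
    · exact fun z _ => (hcell z).prod (hcell z)
  refine le_trans ?_ (mul_le_mul_right h2 _)
  rw [h1]
  have h3 := sq_sum_le_card_mul_sum_sq (s := N) (f := fun z => (μ (P ∩ a ⁻¹' {z})).toNNReal)
  have h4 : ∀ z, ((μ (P ∩ a ⁻¹' {z})).toNNReal : ℝ≥0∞) = μ (P ∩ a ⁻¹' {z}) := fun z =>
    ENNReal.coe_toNNReal (measure_ne_top _ _)
  have h5 := ENNReal.coe_le_coe.2 h3
  push_cast at h5
  simpa only [h4] using h5

/-- The projection of `K'` lies in a cube of half-side `2R` and meets at most `(6R · 2ʲ) ^ m` cells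
of side `2⁻ʲ`. By Cauchy–Schwarz the pairs of `K'` with a common cell have mass at least `(1/4)²`
over that number, and for large `j` injectivity makes them `r`-close. The constant must not depend
on `r`. -/
theorem eventually_le_measure_closePairs {v : Fin m → ℝ} (hv : v ∈ Icc (-1 : Fin m → ℝ) 1)
    {K : Set (EuclideanSpace ℝ (Fin (m + 1)))} (hK : IsCompact K) (hK3 : NoThreeCollinear K)
    (μ : Measure (EuclideanSpace ℝ (Fin (m + 1)))) [IsProbabilityMeasure μ] (hμ : μ Kᶜ = 0)
    {R : ℕ} (hR1 : 1 ≤ R) (hR : ∀ x ∈ K, ∀ i, |x i| ≤ R) {r : ℝ} (hr : 0 < r) :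
    ∀ᶠ j : ℕ in atTop, 16⁻¹ / (6 * R) ^ m ≤
      (2 ^ j) ^ m * (μ.prod μ) (Prod.mk v ⁻¹' closePairs r (2⁻¹ ^ j)) := by
  obtain ⟨K', hK'K, hK', hinj, hK'μ⟩ := exists_isCompact_injOn_slantProj v hK hK3 μ hμ
  obtain ⟨δ, hδ, hδr⟩ := exists_dist_lt_of_injOn (continuous_slantProj v) hK' hinj hr
  have hlim : Tendsto (fun j : ℕ => (2⁻¹ : ℝ) ^ j) atTop (𝓝 0) :=
    tendsto_pow_atTop_nhds_zero_of_lt_one (by norm_num) (by norm_num)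
  filter_upwards [hlim.eventually (gt_mem_nhds hδ)] with j hj
  let a : EuclideanSpace ℝ (Fin (m + 1)) → (Fin m → ℤ) := fun x i => ⌊(2 : ℝ) ^ j * slantProj v x i⌋
  have ha : Measurable a := measurable_pi_lambda _ fun i => Int.measurable_floor.comp
    (((measurable_pi_apply i).comp (continuous_slantProj v).measurable).const_mul _)
  let N : Finset (Fin m → ℤ) := Fintype.piFinset fun _ => Finset.Icc (-(2 ^ j * (2 * R)) : ℤ)
    (2 ^ j * (2 * R))
  have hN : ∀ x ∈ K', a x ∈ N := by
    intro x hx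
    simp only [N, a, Fintype.mem_piFinset, Finset.mem_Icc]
    intro i
    have h1 : |slantProj v x i| ≤ 2 * R := by
      have h2 : |v i| ≤ 1 := abs_le.2 ⟨hv.1 i, hv.2 i⟩
      have h3 := hR x (hK'K hx) i.castSucc
      have h4 := hR x (hK'K hx) (Fin.last m)
      calc |slantProj v x i| ≤ |x i.castSucc| + |x (Fin.last m)| * |v i| := by
            rw [← abs_mul]; exact abs_sub _ _
        _ ≤ R + R * 1 := by gcongr
        _ = 2 * R := by ring
    rw [abs_le] at h1
    constructor
    · rw [Int.le_floor]; push_cast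
      calc (-(2 ^ j * (2 * R)) : ℝ) = 2 ^ j * (-(2 * R)) := by ring
        _ ≤ _ := by gcongr; exact h1.1
    · have : (⌊(2 : ℝ) ^ j * slantProj v x i⌋ : ℝ) ≤ 2 ^ j * (2 * R) :=
        (Int.floor_le _).trans (by gcongr; exact h1.2)
      exact_mod_cast this
  have hcard : (N.card : ℝ≥0∞) ≤ (2 ^ j) ^ m * (6 * R) ^ m := by
    have : N.card ≤ (2 ^ j) ^ m * (6 * R) ^ m := by
      rw [← mul_pow]
      simp only [N, Fintype.card_piFinset, Int.card_Icc, Finset.prod_const, Finset.card_univ,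
        Fintype.card_fin]
      gcongr
      have h2 : 1 ≤ 2 ^ j * R := Nat.one_le_iff_ne_zero.2 (by positivity)
      have h3 : ((2 : ℤ) ^ j * (2 * R) + 1 - -(2 ^ j * (2 * R))).toNat =
          2 ^ j * (2 * R) * 2 + 1 := by
        have : (2 : ℤ) ^ j * (2 * R) + 1 - -(2 ^ j * (2 * R)) =
          ((2 ^ j * (2 * R) * 2 + 1 : ℕ) : ℤ) := by push_cast; ring
        rw [this, Int.toNat_natCast]
      rw [h3]
      nlinarith
    exact_mod_cast this
  have key := sq_measure_le_card_mul μ ha hK'.measurableSet N hN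
  have hsub : {p : _ × _ | p.1 ∈ K' ∧ p.2 ∈ K' ∧ a p.1 = a p.2} ⊆
      Prod.mk v ⁻¹' closePairs r (2⁻¹ ^ j) := by
    rintro ⟨x, y⟩ ⟨hx, hy, hxy⟩
    have hπ : ‖slantProj v (x - y)‖ ≤ 2⁻¹ ^ j := by
      rw [slantProj_sub, pi_norm_le_iff_of_nonneg (by positivity)]
      intro i
      have h := Int.abs_sub_lt_one_of_floor_eq_floor (congrFun hxy i)
      rw [← mul_sub, abs_mul, abs_of_pos (by positivity)] at h
      rw [inv_pow, ← one_div, le_div_iff₀ (by positivity), mul_comm]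
      exact h.le
    refine ⟨hδr x hx y hy ?_, hπ⟩
    rw [dist_eq_norm, ← slantProj_sub]
    exact hπ.trans_lt hj
  have h16 : (16 : ℝ≥0∞)⁻¹ ≤ μ K' ^ 2 := by
    calc (16 : ℝ≥0∞)⁻¹ = 4⁻¹ ^ 2 := by
          rw [← ENNReal.inv_pow]; norm_num
      _ ≤ _ := by gcongr
  refine ENNReal.div_le_of_le_mul ?_
  calc (16 : ℝ≥0∞)⁻¹ ≤ _ := h16.trans key
    _ ≤ ((2 ^ j) ^ m * (6 * R) ^ m) * (μ.prod μ) (Prod.mk v ⁻¹' closePairs r (2⁻¹ ^ j)) := by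
        gcongr
    _ = _ := by ring

end Slant

/-! ### Energy estimate and the upper bound for the dimension -/

section Slicing

variable {m : ℕ}

/-- By Tonelli, integrate over `v` first: a pair with difference `z` contributes at most a constant
times `(2⁻ʲ/‖z‖) ^ m`. Sorting pairs by dyadic size of `‖z‖` and using the ball condition gives the
series. -/
theorem measure_closePairs_le (μ : Measure (EuclideanSpace ℝ (Fin (m + 1))))
    [IsProbabilityMeasure μ] {C : ℝ≥0∞} {s : ℝ}
    (hμ : ∀ x (j : ℕ), μ (Metric.ball x (2⁻¹ ^ j)) ≤ C * dyadicWeight s j) (k₀ j : ℕ) :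
    ((volume.restrict (Icc (-1 : Fin m → ℝ) 1)).prod (μ.prod μ))
        (closePairs (2⁻¹ ^ k₀) (2⁻¹ ^ j)) ≤
      ∑' k, ENNReal.ofReal (16 * (m + 1) * 2⁻¹ ^ j) ^ m *
        ((2 ^ m) ^ (k + k₀) * (C * dyadicWeight s (k + k₀))) := by
  set c : ℝ := 16 * (m + 1) * 2⁻¹ ^ j with hc
  have hc0 : 0 < c := by positivity
  let B : ℕ → Set (EuclideanSpace ℝ (Fin (m + 1)) × EuclideanSpace ℝ (Fin (m + 1))) :=
    fun k => {p | dist p.1 p.2 < 2⁻¹ ^ k}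
  have hB : ∀ k, MeasurableSet (B k) := fun k =>
    (isOpen_lt continuous_dist continuous_const).measurableSet
  have hBμ : ∀ k, (μ.prod μ) (B k) ≤ C * dyadicWeight s k := by
    intro k
    rw [Measure.prod_apply (hB k)]
    calc ∫⁻ x, μ (Prod.mk x ⁻¹' B k) ∂μ ≤ ∫⁻ _, C * dyadicWeight s k ∂μ := by
          refine lintegral_mono fun x => ?_
          convert hμ x k using 2
          ext y
          simp [B, dist_comm]
      _ = _ := by simp
  rw [Measure.prod_apply_symm (measurableSet_closePairs _ _)]
  have hpt : ∀ p : EuclideanSpace ℝ (Fin (m + 1)) × EuclideanSpace ℝ (Fin (m + 1)),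
      volume.restrict (Icc (-1 : Fin m → ℝ) 1)
        ((fun v => (v, p)) ⁻¹' closePairs (2⁻¹ ^ k₀) (2⁻¹ ^ j)) ≤
      ∑' k, ENNReal.ofReal c ^ m * (2 ^ m) ^ (k + k₀) * (B (k + k₀)).indicator 1 p := by
    intro p
    by_cases hd : dist p.1 p.2 < 2⁻¹ ^ k₀
    swap
    · have : (fun v => (v, p)) ⁻¹' closePairs (2⁻¹ ^ k₀) (2⁻¹ ^ j) = (∅ : Set (Fin m → ℝ)) := by
        ext v
        simp only [closePairs, mem_preimage, mem_ofPred_eq, hd, false_and, mem_empty_iff_false]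
      rw [this]; simp
    -- On the diagonal every term of the series is at least a fixed positive constant, so the bound
    -- is infinite and nothing is to be shown.
    by_cases hz : p.1 - p.2 = 0
    · have : ∀ k, ENNReal.ofReal c ^ m ≤
          ENNReal.ofReal c ^ m * (2 ^ m) ^ (k + k₀) * (B (k + k₀)).indicator 1 p := by
        intro k
        have hmem : p ∈ B (k + k₀) := by
          simp [B, sub_eq_zero.1 hz]
        rw [indicator_of_mem hmem, Pi.one_apply, mul_one]
        exact le_mul_of_one_le_right zero_le (one_le_pow₀ (one_le_pow₀ one_le_two))
      refine le_trans ?_ (ENNReal.tsum_le_tsum this)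
      rw [ENNReal.tsum_const_eq_top_of_ne_zero]
      · exact le_top
      · exact pow_ne_zero _ (ENNReal.ofReal_pos.2 hc0).ne'
    · have hz0 : 0 < ‖p.1 - p.2‖ := norm_pos_iff.2 hz
      -- The exponent `k + 2` instead of `k + 1` makes the upper inequality strict, as membership in
      -- `B` requires. The resulting factor 4 turns the constant `4(m + 1)` into `16(m + 1)`.
      obtain ⟨k, hk1, hk2⟩ : ∃ k : ℕ, 2⁻¹ ^ (k + 2) < ‖p.1 - p.2‖ / 2⁻¹ ^ k₀ ∧
          ‖p.1 - p.2‖ / 2⁻¹ ^ k₀ < 2⁻¹ ^ k := by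
        have hlt : ‖p.1 - p.2‖ / 2⁻¹ ^ k₀ < 1 := by
          rw [div_lt_one (by positivity), ← dist_eq_norm]; exact hd
        obtain ⟨k, hk1, hk2⟩ := exists_nat_pow_near_of_lt_one (x := ‖p.1 - p.2‖ / 2⁻¹ ^ k₀)
          (y := (2⁻¹ : ℝ)) (by positivity) hlt.le (by norm_num) (by norm_num)
        cases k with
        | zero => exact ⟨0, lt_trans (by norm_num) hk1, by simpa using hlt⟩
        | succ k => exact ⟨k, hk1, hk2.trans_lt (by
            rw [pow_succ]; linarith [show (0 : ℝ) < 2⁻¹ ^ k by positivity])⟩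
      rw [div_lt_iff₀ (by positivity), ← pow_add] at hk2
      rw [lt_div_iff₀ (by positivity), ← pow_add] at hk1
      have hmem : p ∈ B (k + k₀) := by simpa only [B, mem_ofPred_eq, dist_eq_norm] using hk2
      refine le_trans ?_ (ENNReal.le_tsum k)
      rw [indicator_of_mem hmem, Pi.one_apply, mul_one, Measure.restrict_apply
        (measurable_prodMk_right (measurableSet_closePairs _ _))]
      refine (measure_mono (inter_subset_inter_left _ fun v hv => hv.2)).trans
        ((volume_slantProj_le hz (by positivity)).trans ?_)
      have h2 : (2 : ℝ≥0∞) ^ (k + k₀) = ENNReal.ofReal (2 ^ (k + k₀)) := by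
        rw [ENNReal.ofReal_pow (by norm_num)]; norm_num
      rw [pow_right_comm, ← mul_pow, h2, ← ENNReal.ofReal_mul hc0.le]
      gcongr
      rw [div_le_iff₀ hz0]
      have h3 : (2 : ℝ) ^ (k + k₀) * 2⁻¹ ^ (k + 2 + k₀) = 4⁻¹ := by
        rw [show k + 2 + k₀ = (k + k₀) + 2 by ring, pow_add _ (k + k₀) 2, ← mul_assoc, ← mul_pow]
        norm_num
      calc 4 * ((m : ℝ) + 1) * 2⁻¹ ^ j = c * (2 ^ (k + k₀) * 2⁻¹ ^ (k + 2 + k₀)) := by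
            rw [h3, hc]; ring
        _ ≤ c * (2 ^ (k + k₀) * ‖p.1 - p.2‖) := by gcongr
        _ = _ := by ring
  calc _ ≤ ∫⁻ p, ∑' k, ENNReal.ofReal c ^ m * (2 ^ m) ^ (k + k₀) * (B (k + k₀)).indicator 1 p
        ∂(μ.prod μ) := lintegral_mono hpt
    _ = ∑' k, ENNReal.ofReal c ^ m * (2 ^ m) ^ (k + k₀) * (μ.prod μ) (B (k + k₀)) := by
        rw [lintegral_tsum]
        · refine tsum_congr fun k => ?_
          rw [lintegral_const_mul _ (measurable_one.indicator (hB _)),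
            lintegral_indicator_one (hB _)]
        · exact fun k => ((measurable_one.indicator (hB _)).const_mul _).aemeasurable
    _ ≤ _ := by
        refine ENNReal.tsum_le_tsum fun k => ?_
        rw [mul_assoc]
        gcongr
        exact hBμ _

theorem tsum_two_pow_mul_dyadicWeight_ne_top {s : ℝ} (hs : (m : ℝ) < s) :
    ∑' k, (2 ^ m) ^ k * dyadicWeight s k ≠ ⊤ := by
  have h : ∀ k, (2 ^ m) ^ k * dyadicWeight s k = (2 ^ m * 2⁻¹ ^ s : ℝ≥0∞) ^ k := by
    intro k
    rw [dyadicWeight, mul_pow, ← ENNReal.rpow_natCast (2⁻¹ : ℝ≥0∞) k, ← ENNReal.rpow_mul,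
      mul_comm (k : ℝ), ENNReal.rpow_mul, ENNReal.rpow_natCast]
  have hlt : (2 ^ m * 2⁻¹ ^ s : ℝ≥0∞) < 1 := by
    rw [ENNReal.inv_rpow, ← ENNReal.rpow_natCast, ← div_eq_mul_inv]
    refine ENNReal.div_lt_of_lt_mul ?_
    rw [one_mul]
    exact ENNReal.rpow_lt_rpow_of_exponent_lt (by norm_num) (by simp) hs
  simp_rw [h, ENNReal.tsum_geometric]
  exact ENNReal.inv_ne_top.2 (tsub_pos_of_lt hlt).ne'

/-- A Borel set without three collinear points has codimension at least one. -/
theorem dimH_le_of_noThreeCollinear {A : Set (EuclideanSpace ℝ (Fin (m + 1)))}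
    (hA : MeasurableSet A) (hA3 : NoThreeCollinear A) : dimH A ≤ (m : ℕ) := by
  by_contra! hlt
  obtain ⟨s, hms, hsA⟩ := ENNReal.lt_iff_exists_nnreal_btwn.1 hlt
  have hms' : (m : ℝ) < s := by exact_mod_cast hms
  have hs0 : (0 : ℝ) < s := lt_of_le_of_lt (Nat.cast_nonneg m) hms'
  have hH : μH[s] A ≠ 0 := by rw [hausdorffMeasure_of_lt_dimH hsA]; simp
  obtain ⟨K, μ, C, hKA, hK, hμp, hμK, hC, hμ⟩ := exists_frostman_measure hA hs0 hH
  have hK3 : NoThreeCollinear K := fun x hx y hy z hz =>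
    hA3 x (hKA hx) y (hKA hy) z (hKA hz)
  obtain ⟨R, hR1, hR⟩ : ∃ R : ℕ, 1 ≤ R ∧ ∀ x ∈ K, ∀ i, |x i| ≤ R := by
    obtain ⟨R, hR⟩ := hK.isBounded.exists_norm_le
    refine ⟨⌈R⌉₊ + 1, by omega, fun x hx i => ?_⟩
    push_cast
    exact (PiLp.norm_apply_le x i).trans ((hR x hx).trans (by linarith [Nat.le_ceil R]))
  set c₀ : ℝ≥0∞ := 16⁻¹ / (6 * R) ^ m with hc₀
  have hc₀0 : c₀ ≠ 0 := by
    refine (ENNReal.div_pos (by simp) ?_).ne'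
    exact ENNReal.pow_ne_top (ENNReal.mul_ne_top (by simp) (by simp))
  set c₁ : ℝ≥0∞ := ENNReal.ofReal (16 * (m + 1)) ^ m * C with hc₁
  have hc₁top : c₁ ≠ ⊤ := ENNReal.mul_ne_top (ENNReal.pow_ne_top ENNReal.ofReal_ne_top) hC
  -- The left side, `c₀` times the volume of the cube of parameters, does not depend on `k₀`; the
  -- right side is a tail of a convergent series.
  have key : ∀ k₀ : ℕ, c₀ * 2 ^ m ≤
      c₁ * ∑' k, (2 ^ m) ^ (k + k₀) * dyadicWeight s (k + k₀) := by
    intro k₀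
    let ν := volume.restrict (Icc (-1 : Fin m → ℝ) 1)
    let D : ℕ → (Fin m → ℝ) → ℝ≥0∞ := fun j v =>
      (2 ^ j) ^ m * (μ.prod μ) (Prod.mk v ⁻¹' closePairs (2⁻¹ ^ k₀) (2⁻¹ ^ j))
    have hD : ∀ j, Measurable (D j) := fun j =>
      (measurable_measure_prodMk_left (measurableSet_closePairs _ _)).const_mul _
    have hDint : ∀ j, ∫⁻ v, D j v ∂ν ≤
        c₁ * ∑' k, (2 ^ m) ^ (k + k₀) * dyadicWeight s (k + k₀) := by
      intro j
      simp only [D]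
      rw [lintegral_const_mul _ (measurable_measure_prodMk_left (measurableSet_closePairs _ _)),
        ← Measure.prod_apply (measurableSet_closePairs _ _)]
      refine (mul_le_mul_right (measure_closePairs_le μ hμ k₀ j) _).trans (le_of_eq ?_)
      rw [← ENNReal.tsum_mul_left, ← ENNReal.tsum_mul_left]
      refine tsum_congr fun k => ?_
      have h2 : ENNReal.ofReal (16 * (m + 1) * 2⁻¹ ^ j) ^ m * (2 ^ j) ^ m =
          ENNReal.ofReal (16 * (m + 1)) ^ m := by
        have : (2 : ℝ≥0∞) ^ j = ENNReal.ofReal (2 ^ j) := by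
          rw [ENNReal.ofReal_pow (by norm_num)]; norm_num
        rw [← mul_pow, this, ← ENNReal.ofReal_mul (by positivity), mul_assoc, ← mul_pow]
        norm_num
      rw [hc₁, ← h2]
      ring
    have hlim : ∀ v ∈ Icc (-1 : Fin m → ℝ) 1, c₀ ≤ liminf (fun j => D j v) atTop := fun v hv =>
      le_liminf_of_le (by isBoundedDefault)
        (eventually_le_measure_closePairs hv hK hK3 μ hμK hR1 hR (by positivity))
    calc c₀ * 2 ^ m = ∫⁻ _, c₀ ∂ν := by
          simp [ν, Real.volume_Icc_pi]
          norm_num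
      _ ≤ ∫⁻ v, liminf (fun j => D j v) atTop ∂ν := by
          refine setLIntegral_mono' measurableSet_Icc hlim
      _ ≤ liminf (fun j => ∫⁻ v, D j v ∂ν) atTop := lintegral_liminf_le hD
      _ ≤ _ := liminf_le_of_frequently_le' (Frequently.of_forall hDint)
  have htail := ENNReal.Tendsto.const_mul (a := c₁)
    (ENNReal.tendsto_sum_nat_add _ (tsum_two_pow_mul_dyadicWeight_ne_top hms')) (Or.inr hc₁top)
  rw [mul_zero] at htail
  have := ge_of_tendsto' htail key
  simp [hc₀0] at this

end Slicing

/-! ### Uniform measure on digit sequences -/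

/-- A product of finite groups carries a probability measure for which the measure of a set is at
most the proportion of its points among those with prescribed coordinates from the `J`-th one on. -/
theorem exists_isProbabilityMeasure_mul_prod_card_le (I : ℕ → Type) [∀ j, Fintype (I j)]
    [∀ j, AddCommGroup (I j)] [∀ j, TopologicalSpace (I j)] [∀ j, DiscreteTopology (I j)]
    [MeasurableSpace (∀ j, I j)] [BorelSpace (∀ j, I j)] :
    ∃ μ : Measure (∀ j, I j), IsProbabilityMeasure μ ∧
      ∀ (J : ℕ) (A : Set (∀ j, I j)) (M : ℕ), MeasurableSet A →
        (∀ W : Finset (∀ j, I j), (∀ x ∈ W, x ∈ A) →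
          (∀ x ∈ W, ∀ y ∈ W, ∀ i ≥ J, x i = y i) → W.card ≤ M) →
        μ A * ((∏ i ∈ Finset.range J, Fintype.card (I i) : ℕ) : ℝ≥0∞) ≤ M := by
  classical
  let K₀ : TopologicalSpace.PositiveCompacts (∀ j, I j) := ⊤
  refine ⟨Measure.addHaarMeasure K₀, ⟨?_⟩, fun J A M hA hcard => ?_⟩
  · simpa [K₀] using Measure.addHaarMeasure_self (K₀ := K₀)
  have hprob : IsProbabilityMeasure (Measure.addHaarMeasure K₀) :=
    ⟨by simpa [K₀] using Measure.addHaarMeasure_self (K₀ := K₀)⟩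
  set μ := Measure.addHaarMeasure K₀
  let emb : (∀ i : Fin J, I i) → ∀ j, I j := fun g i => if h : i < J then g ⟨i, h⟩ else 0
  have hemb : Function.Injective emb := by
    intro g g' h
    ext i
    have := congrFun h i
    simpa [emb] using this
  have hcardG : ∏ i ∈ Finset.range J, Fintype.card (I i) = Fintype.card (∀ i : Fin J, I i) := by
    rw [Fintype.card_pi, Finset.prod_range]
  have hmeas : ∀ g, MeasurableSet ((fun ω => emb g + ω) ⁻¹' A) := fun g =>
    (measurable_const_add _) hA
  -- By invariance all translates of `A` by elements supported on the first `J` coordinates have the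
  -- same measure, and every `ω` lies in at most `M` of them.
  calc μ A * ((∏ i ∈ Finset.range J, Fintype.card (I i) : ℕ) : ℝ≥0∞)
      = ∑ g : ∀ i : Fin J, I i, μ ((fun ω => emb g + ω) ⁻¹' A) := by
        simp_rw [measure_preimage_add]
        rw [hcardG, Finset.sum_const, nsmul_eq_mul, mul_comm, Finset.card_univ]
    _ = ∫⁻ ω, ∑ g : ∀ i : Fin J, I i, ((fun ω => emb g + ω) ⁻¹' A).indicator 1 ω ∂μ := by
        rw [lintegral_finsetSum]
        · exact Finset.sum_congr rfl fun g _ => (lintegral_indicator_one (hmeas g)).symm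
        · exact fun g _ => measurable_one.indicator (hmeas g)
    _ ≤ ∫⁻ _, (M : ℝ≥0∞) ∂μ := by
        refine lintegral_mono fun ω => ?_
        have h := hcard ((Finset.univ.filter fun g => emb g + ω ∈ A).image fun g => emb g + ω)
          (by simp) (by
            intro x hx y hy i hi
            obtain ⟨g, -, rfl⟩ := Finset.mem_image.1 hx
            obtain ⟨g', -, rfl⟩ := Finset.mem_image.1 hy
            simp [emb, not_lt.2 hi])
        rw [Finset.card_image_of_injective _ fun g g' hg => hemb (add_right_cancel hg)] at h
        calc ∑ g, ((fun ω => emb g + ω) ⁻¹' A).indicator (1 : (∀ j, I j) → ℝ≥0∞) ω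
            = ((Finset.univ.filter fun g => emb g + ω ∈ A).card : ℝ≥0∞) := by
              simp [indicator]
          _ ≤ M := by exact_mod_cast h
    _ = M := by simp

/-! ### Scales, digits and shifts of the construction -/

/-- The pieces of stage `j` of the construction have side `2 ^ (-scaleExp m j)`. -/
def scaleExp (m : ℕ) : ℕ → ℕ
  | 0 => 0
  | j + 1 => 2 * (scaleExp m j + (m + 1) * ((j + 1) * (scaleExp m j + 1))) + j + 8

/-- The digits of stage `j` are less than `2 ^ digitExp m j`. -/
def digitExp (m j : ℕ) : ℕ := (j + 1) * (scaleExp m j + 1)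

/-- The lattice of stage `j` has mesh `2 ^ (-gridExp m j)`. -/
def gridExp (m j : ℕ) : ℕ := scaleExp m j + (m + 1) * digitExp m j

/-- The choices at stage `j`: for each coordinate of the plane, `m + 1` digits that determine the
position in the lattice of the next piece. -/
abbrev Digits (m j : ℕ) : Type := Fin 2 → Fin (m + 1) → Fin (2 ^ digitExp m j)

/-- The points of the set to be constructed are indexed by sequences of digits. -/
abbrev DigitSeq (m : ℕ) : Type := ∀ j, Digits m j

section

variable {m : ℕ}

/-- The next side is the squared mesh times `2 ^ (-(j + 8))`. Hence it is smaller than the shift `2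
^ (-(2 * gridExp m j + 2))` by a factor that tends to infinity with `j`, yet stays near the inverse
of the number of pieces, since `digitExp` dominates `scaleExp`. -/
theorem scaleExp_succ (j : ℕ) : scaleExp m (j + 1) = 2 * gridExp m j + j + 8 := rfl

theorem scaleExp_le_gridExp (j : ℕ) : scaleExp m j ≤ gridExp m j := Nat.le_add_right _ _

theorem digitExp_le_gridExp (j : ℕ) : digitExp m j ≤ gridExp m j := by
  unfold gridExp; nlinarith [Nat.zero_le (scaleExp m j), Nat.zero_le (m * digitExp m j)]

theorem scaleExp_strictMono : StrictMono (scaleExp m) :=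
  strictMono_nat_of_lt_succ fun j => by
    rw [scaleExp_succ]; have := scaleExp_le_gridExp (m := m) j; omega

theorem two_mul_gridExp_add_two_le {j k : ℕ} (h : j < k) : 2 * gridExp m j + 2 ≤ gridExp m k := by
  have h1 : scaleExp m (j + 1) ≤ scaleExp m k := scaleExp_strictMono.monotone h
  have h2 := scaleExp_le_gridExp (m := m) k
  rw [scaleExp_succ] at h1
  omega

/-- The position in the lattice, relative to the corner of the piece, of the chosen next piece. -/
def cellPos {j : ℕ} (i : Digits m j) (c : Fin 2) : ℕ := (finFunctionFinEquiv (i c)).val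

theorem cellPos_lt {j : ℕ} (i : Digits m j) (c : Fin 2) :
    cellPos i c < 2 ^ ((m + 1) * digitExp m j) := by
  rw [mul_comm, pow_mul]; exact (finFunctionFinEquiv (i c)).2

theorem cellPos_injective {j : ℕ} : Function.Injective (cellPos : Digits m j → Fin 2 → ℕ) := by
  intro i i' h
  funext c
  exact finFunctionFinEquiv.injective (Fin.ext (congrFun h c))

/-- A finite sequence of digits together with a coordinate of the plane. -/
abbrev ShiftData (m : ℕ) : Type := Σ k : ℕ, (∀ i : Fin k, Digits m i) × Fin 2

theorem exists_surjective_shiftData (m : ℕ) : ∃ e : ℕ → ShiftData m, Function.Surjective e :=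
  have : Nonempty (ShiftData m) := ⟨⟨0, fun i => i.elim0, 0⟩⟩
  exists_surjective_nat _

/-- At stage `j` the pieces whose digits begin as prescribed by `e` are shifted along the coordinate
`c` prescribed by `e`. Each prescription is used at infinitely many stages. -/
def IsShifted (e : ℕ → ShiftData m) (j : ℕ) (x : DigitSeq m) (c : Fin 2) : Prop :=
  (e j.unpair.1).1 ≤ j ∧ c = (e j.unpair.1).2.2 ∧
    ∀ i : Fin (e j.unpair.1).1, x i = (e j.unpair.1).2.1 i

open Classical in
/-- The size of the shift at stage `j`. -/
noncomputable def shift (e : ℕ → ShiftData m) (j : ℕ) (x : DigitSeq m) (c : Fin 2) : ℝ :=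
  if IsShifted e j x c then ((2 : ℝ) ^ (2 * gridExp m j + 2))⁻¹ else 0

/-- The displacement at stage `j`. -/
noncomputable def displacement (e : ℕ → ShiftData m) (j : ℕ) (x : DigitSeq m) (c : Fin 2) : ℝ :=
  cellPos (x j) c / 2 ^ gridExp m j + shift e j x c

/-- The point of the plane with a given sequence of digits. -/
noncomputable def planePoint (e : ℕ → ShiftData m) (x : DigitSeq m) : EuclideanSpace ℝ (Fin 2) :=
  WithLp.toLp 2 fun c => ∑' j, displacement e j x c

/-- The value at stage `j` of the `i`-th digit, normalised to lie in `[0, 1)`. -/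
noncomputable def digitValue (j : ℕ) (x : DigitSeq m) (i : Fin m) : ℝ :=
  (x j 0 i.castSucc : ℕ) / 2 ^ digitExp m j

/-- The value of the function at the point of the plane with a given sequence of digits. -/
noncomputable def heightPoint (x : DigitSeq m) : EuclideanSpace ℝ (Fin m) :=
  WithLp.toLp 2 fun i => ∑' j, (2 : ℝ)⁻¹ ^ j * digitValue j x i

variable (e : ℕ → ShiftData m)

theorem shift_nonneg (j : ℕ) (x : DigitSeq m) (c : Fin 2) : 0 ≤ shift e j x c := by
  unfold shift; split_ifs <;> positivity

/-- A prescription used at stage `j` has length at most `j`, so points that first differ at stage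
`j` are shifted together there. -/
theorem shift_congr {j : ℕ} {x y : DigitSeq m} (h : ∀ i < j, x i = y i) (c : Fin 2) :
    shift e j x c = shift e j y c := by
  have : IsShifted e j x c ↔ IsShifted e j y c := by
    unfold IsShifted
    refine and_congr_right fun hj => and_congr_right fun _ => forall_congr' fun i => ?_
    rw [h i (i.2.trans_le hj)]
  unfold shift
  by_cases hx : IsShifted e j x c
  · rw [if_pos hx, if_pos (this.1 hx)]
  · rw [if_neg hx, if_neg (mt this.2 hx)]

theorem displacement_nonneg (j : ℕ) (x : DigitSeq m) (c : Fin 2) : 0 ≤ displacement e j x c :=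
  add_nonneg (by positivity) (shift_nonneg e j x c)

theorem displacement_le (j : ℕ) (x : DigitSeq m) (c : Fin 2) :
    displacement e j x c ≤ 2⁻¹ ^ scaleExp m j := by
  have h1 : shift e j x c ≤ (2 ^ gridExp m j)⁻¹ := by
    unfold shift
    split_ifs
    · exact inv_anti₀ (by positivity) (pow_le_pow_right₀ (by norm_num) (by omega))
    · positivity
  have h2 : (cellPos (x j) c : ℝ) + 1 ≤ 2 ^ ((m + 1) * digitExp m j) := by
    exact_mod_cast cellPos_lt (x j) c
  have h3 : (2 : ℝ) ^ gridExp m j = 2 ^ scaleExp m j * 2 ^ ((m + 1) * digitExp m j) := by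
    rw [← pow_add]; rfl
  calc displacement e j x c ≤ cellPos (x j) c / 2 ^ gridExp m j + (2 ^ gridExp m j)⁻¹ := by
        unfold displacement; gcongr
    _ = (cellPos (x j) c + 1) / 2 ^ gridExp m j := by ring
    _ ≤ 2 ^ ((m + 1) * digitExp m j) / 2 ^ gridExp m j := by gcongr
    _ = _ := by rw [h3, inv_pow]; field_simp

theorem displacement_congr {j : ℕ} {x y : DigitSeq m} (h : ∀ i ≤ j, x i = y i) (c : Fin 2) :
    displacement e j x c = displacement e j y c := by
  unfold displacement
  rw [shift_congr e (fun i hi => h i hi.le), h j le_rfl]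

end

/-! ### Convergence, lattice approximation, injectivity and continuity -/

/-- A series of nonnegative terms bounded by `2 ^ (-D j)`, with `D` strictly increasing. -/
theorem summable_of_le_two_pow {D : ℕ → ℕ} (hD : StrictMono D) {t : ℕ → ℝ} (h0 : ∀ j, 0 ≤ t j)
    (h1 : ∀ j, t j ≤ 2⁻¹ ^ D j) : Summable t :=
  Summable.of_nonneg_of_le h0 (fun j => (h1 j).trans
    (pow_le_pow_of_le_one (by norm_num) (by norm_num) (hD.id_le j)))
    (summable_geometric_of_lt_one (by norm_num) (by norm_num : (2⁻¹ : ℝ) < 1))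

theorem tsum_nat_add_le_of_le_two_pow {D : ℕ → ℕ} (hD : StrictMono D) {t : ℕ → ℝ}
    (h0 : ∀ j, 0 ≤ t j) (h1 : ∀ j, t j ≤ 2⁻¹ ^ D j) (k : ℕ) :
    ∑' j, t (j + k) ≤ 2 * 2⁻¹ ^ D k := by
  have hge : ∀ j, D k + j ≤ D (j + k) := by
    intro j
    induction j with
    | zero => simp
    | succ j ih =>
      have := hD (show j + k < j + 1 + k by omega)
      omega
  have hle : ∀ j, t (j + k) ≤ 2⁻¹ ^ D k * 2⁻¹ ^ j := fun j => (h1 _).trans (by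
    rw [← pow_add]
    exact pow_le_pow_of_le_one (by norm_num) (by norm_num) (hge j))
  have hs := (summable_geometric_of_lt_one (by norm_num) (by norm_num : (2⁻¹ : ℝ) < 1)).mul_left
    ((2⁻¹ : ℝ) ^ D k)
  refine ((Summable.of_nonneg_of_le (fun j => h0 _) hle hs).tsum_le_tsum hle hs).trans_eq ?_
  rw [tsum_mul_left, tsum_geometric_of_lt_one (by norm_num) (by norm_num)]
  norm_num [mul_comm]

section

variable {m : ℕ} (e : ℕ → ShiftData m)

theorem summable_displacement (x : DigitSeq m) (c : Fin 2) :
    Summable fun j => displacement e j x c :=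
  summable_of_le_two_pow scaleExp_strictMono (displacement_nonneg e · x c) (displacement_le e · x c)

theorem tsum_displacement_nat_add_nonneg (x : DigitSeq m) (c : Fin 2) (k : ℕ) :
    0 ≤ ∑' j, displacement e (j + k) x c := tsum_nonneg fun _ => displacement_nonneg e _ x c

theorem tsum_displacement_nat_add_le (x : DigitSeq m) (c : Fin 2) (k : ℕ) :
    ∑' j, displacement e (j + k) x c ≤ 2 * 2⁻¹ ^ scaleExp m k :=
  tsum_nat_add_le_of_le_two_pow (t := fun j => displacement e j x c) scaleExp_strictMono
    (displacement_nonneg e · x c) (displacement_le e · x c) k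

theorem planePoint_apply_eq (x : DigitSeq m) (c : Fin 2) (k : ℕ) :
    planePoint e x c = ∑ j ∈ Finset.range k, displacement e j x c +
      cellPos (x k) c / 2 ^ gridExp m k + shift e k x c +
      ∑' j, displacement e (j + (k + 1)) x c := by
  have := (summable_displacement e x c).sum_add_tsum_nat_add (k + 1)
  rw [Finset.sum_range_succ] at this
  change ∑' j, displacement e j x c = _
  rw [← this]
  change _ + (cellPos (x k) c / 2 ^ gridExp m k + shift e k x c) + _ = _
  ring

theorem planePoint_nonneg (x : DigitSeq m) (c : Fin 2) : 0 ≤ planePoint e x c :=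
  tsum_nonneg fun _ => displacement_nonneg e _ x c

theorem planePoint_le (x : DigitSeq m) (c : Fin 2) : planePoint e x c ≤ 2 := by
  simpa [scaleExp, planePoint] using tsum_displacement_nat_add_le e x c 0

/-- Earlier cell positions and shifts are multiples of `2 ^ (-(2 * gridExp m j + 2))`, and this is a
multiple of the mesh of every later stage. -/
theorem exists_int_eq_sum_displacement (x : DigitSeq m) (c : Fin 2) (k : ℕ) :
    ∃ z : ℤ, ∑ j ∈ Finset.range k, displacement e j x c = z / 2 ^ gridExp m k := by
  have hterm : ∀ j < k, ∃ z : ℤ, displacement e j x c = z / 2 ^ gridExp m k := by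
    intro j hj
    have hle := two_mul_gridExp_add_two_le (m := m) hj
    obtain ⟨p, hp⟩ := Nat.exists_eq_add_of_le hle
    have hp2 : (2 : ℝ) ^ gridExp m k = 2 ^ gridExp m j * 2 ^ (gridExp m j + 2 + p) := by
      rw [← pow_add, hp]; congr 1; ring
    have hp3 : (2 : ℝ) ^ gridExp m k = 2 ^ (2 * gridExp m j + 2) * 2 ^ p := by
      rw [← pow_add, hp]
    by_cases hs : IsShifted e j x c
    · refine ⟨cellPos (x j) c * 2 ^ (gridExp m j + 2 + p) + 2 ^ p, ?_⟩
      rw [displacement, shift, if_pos hs]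
      push_cast
      rw [add_div]
      congr 1
      · rw [hp2]; field_simp
      · rw [hp3]; field_simp
    · refine ⟨cellPos (x j) c * 2 ^ (gridExp m j + 2 + p), ?_⟩
      rw [displacement, shift, if_neg hs]
      push_cast
      rw [hp2]; field_simp; simp
  choose! z hz using hterm
  refine ⟨∑ j ∈ Finset.range k, z j, ?_⟩
  push_cast
  rw [Finset.sum_div]
  exact Finset.sum_congr rfl fun j hj => hz j (Finset.mem_range.1 hj)

/-- Up to an error of the order of the next scale, all points lie, after undoing the shift, on the
lattice of stage `k`. -/
theorem exists_lattice_approx (x : DigitSeq m) (k : ℕ) : ∃ z : Fin 2 → ℤ, ∀ c,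
    |planePoint e x c - z c / 2 ^ gridExp m k - shift e k x c| ≤ 2 * 2⁻¹ ^ scaleExp m (k + 1) := by
  choose z hz using fun c => exists_int_eq_sum_displacement e x c k
  refine ⟨fun c => z c + cellPos (x k) c, fun c => ?_⟩
  have h1 := tsum_displacement_nat_add_le e x c (k + 1)
  have h2 := tsum_displacement_nat_add_nonneg e x c (k + 1)
  have : planePoint e x c - (z c + cellPos (x k) c : ℤ) / 2 ^ gridExp m k - shift e k x c =
      ∑' j, displacement e (j + (k + 1)) x c := by
    rw [planePoint_apply_eq e x c k, hz]; push_cast; ring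
  rw [this, abs_of_nonneg h2]
  exact h1

theorem abs_planePoint_sub_sub_le {x y : DigitSeq m} {k : ℕ} (h : ∀ i < k, x i = y i) (c : Fin 2) :
    |planePoint e x c - planePoint e y c -
      ((cellPos (x k) c : ℝ) - cellPos (y k) c) / 2 ^ gridExp m k| ≤
        2 * 2⁻¹ ^ scaleExp m (k + 1) := by
  have hsum : ∑ j ∈ Finset.range k, displacement e j x c =
      ∑ j ∈ Finset.range k, displacement e j y c := Finset.sum_congr rfl fun j hj =>
    displacement_congr e (fun i hi => h i (hi.trans_lt (Finset.mem_range.1 hj))) c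
  rw [planePoint_apply_eq e x c k, planePoint_apply_eq e y c k, hsum, shift_congr e h]
  have h1 := tsum_displacement_nat_add_le e x c (k + 1)
  have h2 := tsum_displacement_nat_add_nonneg e x c (k + 1)
  have h3 := tsum_displacement_nat_add_le e y c (k + 1)
  have h4 := tsum_displacement_nat_add_nonneg e y c (k + 1)
  rw [abs_le]
  constructor <;> ring_nf <;> ring_nf at h1 h2 h3 h4 <;> linarith

/-- Sequences that first differ at stage `k` give points at distance at least the scale of the next
stage. -/
theorem exists_two_pow_le_abs_planePoint_sub {x y : DigitSeq m} {k : ℕ} (h : ∀ i < k, x i = y i)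
    (hk : x k ≠ y k) : ∃ c, 2⁻¹ ^ scaleExp m (k + 1) ≤ |planePoint e x c - planePoint e y c| := by
  obtain ⟨c, hc⟩ : ∃ c, cellPos (x k) c ≠ cellPos (y k) c := by
    by_contra! hcon
    exact hk (cellPos_injective (funext hcon))
  refine ⟨c, ?_⟩
  have h1 := abs_planePoint_sub_sub_le e h c
  set A := planePoint e x c - planePoint e y c
  have h2 : (2⁻¹ : ℝ) ^ gridExp m k ≤
      |((cellPos (x k) c : ℝ) - cellPos (y k) c) / 2 ^ gridExp m k| := by
    rw [abs_div, abs_of_pos (show (0 : ℝ) < 2 ^ gridExp m k by positivity), inv_pow, ← one_div]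
    gcongr
    have : (1 : ℤ) ≤ |(cellPos (x k) c : ℤ) - cellPos (y k) c| :=
      Int.one_le_abs (sub_ne_zero.2 (by exact_mod_cast hc))
    exact_mod_cast this
  -- The tails cost at most two sides of the next stage, so a mesh of at least three of them leaves
  -- one.
  have h3 : 3 * (2⁻¹ : ℝ) ^ scaleExp m (k + 1) ≤ 2⁻¹ ^ gridExp m k := by
    have : (2⁻¹ : ℝ) ^ scaleExp m (k + 1) ≤ 2⁻¹ ^ (gridExp m k + 2) :=
      pow_le_pow_of_le_one (by norm_num) (by norm_num) (by rw [scaleExp_succ]; omega)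
    rw [pow_add] at this
    have h0 : (0 : ℝ) < 2⁻¹ ^ gridExp m k := by positivity
    linarith
  have h4 := abs_sub_abs_le_abs_sub A (A - (A - ((cellPos (x k) c : ℝ) - cellPos (y k) c) /
    2 ^ gridExp m k))
  have h5 := abs_sub_abs_le_abs_sub (((cellPos (x k) c : ℝ) - cellPos (y k) c) / 2 ^ gridExp m k) A
  rw [abs_sub_comm] at h1
  linarith

theorem exists_first_difference {x y : DigitSeq m} (h : x ≠ y) :
    ∃ k, (∀ i < k, x i = y i) ∧ x k ≠ y k := by
  classical
  have hex : ∃ k, x k ≠ y k := Function.ne_iff.1 h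
  exact ⟨Nat.find hex, fun i hi => not_not.1 (Nat.find_min hex hi), Nat.find_spec hex⟩

theorem planePoint_injective : Function.Injective (planePoint e) := by
  intro x y hxy
  by_contra hne
  obtain ⟨k, hk, hk'⟩ := exists_first_difference hne
  obtain ⟨c, hc⟩ := exists_two_pow_le_abs_planePoint_sub e hk hk'
  rw [hxy, sub_self, abs_zero] at hc
  exact absurd hc (not_le.2 (by positivity))

theorem continuous_of_eq_of_forall_lt {ι : Type} {Y : ι → Type} [∀ i, TopologicalSpace (Y i)]
    [∀ i, DiscreteTopology (Y i)] {f : (∀ i, Y i) → ℝ} (s : Finset ι)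
    (h : ∀ x y, (∀ i ∈ s, x i = y i) → f x = f y) : Continuous f := by
  refine IsLocallyConstant.continuous ((IsLocallyConstant.iff_exists_open f).2 fun x => ?_)
  refine ⟨Set.pi s fun i => {x i}, isOpen_set_pi s.finite_toSet fun i _ => isOpen_discrete _,
    by simp, fun y hy => h y x fun i hi => ?_⟩
  simpa using hy i hi

theorem continuous_displacement (j : ℕ) (c : Fin 2) : Continuous fun x => displacement e j x c :=
  continuous_of_eq_of_forall_lt (Finset.range (j + 1)) fun x y h =>
    displacement_congr e (fun i hi => h i (Finset.mem_range.2 (by omega))) c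

theorem continuous_planePoint : Continuous (planePoint e) := by
  refine (PiLp.continuous_toLp 2 _).comp (continuous_pi fun c => ?_)
  refine continuous_tsum (u := fun j => (2⁻¹ : ℝ) ^ j) (continuous_displacement e · c)
    (summable_geometric_of_lt_one (by norm_num) (by norm_num)) fun j x => ?_
  rw [Real.norm_of_nonneg (displacement_nonneg e j x c)]
  exact (displacement_le e j x c).trans
    (pow_le_pow_of_le_one (by norm_num) (by norm_num) (scaleExp_strictMono.id_le j))

theorem digitValue_nonneg (j : ℕ) (x : DigitSeq m) (i : Fin m) : 0 ≤ digitValue j x i := by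
  unfold digitValue; positivity

theorem digitValue_le (j : ℕ) (x : DigitSeq m) (i : Fin m) : digitValue j x i ≤ 1 := by
  unfold digitValue
  rw [div_le_one (by positivity)]
  exact_mod_cast (x j 0 i.castSucc).2.le

theorem two_pow_mul_digitValue_le (j : ℕ) (x : DigitSeq m) (i : Fin m) :
    (2 : ℝ)⁻¹ ^ j * digitValue j x i ≤ 2⁻¹ ^ j :=
  mul_le_of_le_one_right (by positivity) (digitValue_le j x i)

theorem two_pow_mul_digitValue_nonneg (j : ℕ) (x : DigitSeq m) (i : Fin m) :
    0 ≤ (2 : ℝ)⁻¹ ^ j * digitValue j x i :=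
  mul_nonneg (by positivity) (digitValue_nonneg j x i)

theorem continuous_heightPoint : Continuous (heightPoint (m := m)) := by
  refine (PiLp.continuous_toLp 2 _).comp (continuous_pi fun i => ?_)
  refine continuous_tsum (u := fun j => (2⁻¹ : ℝ) ^ j) (fun j => continuous_const.mul ?_)
    (summable_geometric_of_lt_one (by norm_num) (by norm_num)) fun j x => ?_
  · refine continuous_of_eq_of_forall_lt {j} fun x y h => ?_
    unfold digitValue
    rw [h j (Finset.mem_singleton_self j)]
  · rw [Real.norm_of_nonneg (two_pow_mul_digitValue_nonneg j x i)]
    exact two_pow_mul_digitValue_le j x i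

/-- Sequences that differ only at stage `k` give values that differ by a multiple of the difference
of their digits at that stage. -/
theorem heightPoint_sub_eq {x y : DigitSeq m} {k : ℕ} (h : ∀ i, i ≠ k → x i = y i) (i : Fin m) :
    heightPoint x i - heightPoint y i = 2⁻¹ ^ k *
      (((x k 0 i.castSucc : ℕ) : ℝ) - (y k 0 i.castSucc : ℕ)) / 2 ^ digitExp m k := by
  have hs : ∀ x : DigitSeq m, Summable fun j => (2 : ℝ)⁻¹ ^ j * digitValue j x i := fun x =>
    summable_of_le_two_pow strictMono_id (two_pow_mul_digitValue_nonneg · x i)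
      (two_pow_mul_digitValue_le · x i)
  change ∑' j, _ - ∑' j, _ = _
  rw [← (hs x).tsum_sub (hs y), tsum_eq_single k]
  · unfold digitValue; ring
  · intro j hj
    unfold digitValue
    rw [h j hj, sub_self]

end

/-! ### No direction occurs twice -/

section

variable {m : ℕ} {e : ℕ → ShiftData m}

/-- The integer `N` cannot be the sum of a small nonzero number and a smaller error. -/
theorem int_not_near {N : ℤ} {a b : ℝ} (h : (N : ℝ) = a + b) (hab : |b| < |a|)
    (h1 : |a| + |b| < 1) : False := by
  have h2 : |(N : ℝ)| < 1 := by rw [h]; exact (abs_add_le a b).trans_lt h1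
  have h3 : N = 0 := by
    have : |N| < 1 := by exact_mod_cast h2
    exact Int.abs_lt_one_iff.1 this
  rw [h3, Int.cast_zero] at h
  have : a = -b := by linarith
  rw [this, abs_neg] at hab
  exact lt_irrefl _ hab

/-- The numerical core of the argument: `u` is close to `A / N - τ` in one coordinate and to `A / N`
in the other, `d` is close to `B / N` in both, and `u`, `d` are not parallel. -/
theorem cross_ne_zero_of_lattice {N η d₀ d₁ u₀ u₁ τ : ℝ} {A₀ A₁ B₀ B₁ : ℤ} (hN : 0 < N)
    (hτ : τ = (4 * N ^ 2)⁻¹) (hη : 0 ≤ η) (hη1 : 32 * η < N⁻¹ ^ 2) (hη2 : 64 * η < |d₁| * N⁻¹ ^ 2)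
    (hN1 : 1 ≤ N) (hd₀ : |d₀| ≤ 2) (hd₁ : |d₁| ≤ 2) (hu₀ : |u₀| ≤ 2) (hu₁ : |u₁| ≤ 2)
    (h₁ : |u₀ - A₀ / N + τ| ≤ η) (h₂ : |u₁ - A₁ / N| ≤ η) (h₃ : |d₀ - B₀ / N| ≤ η)
    (h₄ : |d₁ - B₁ / N| ≤ η) : u₀ * d₁ - u₁ * d₀ ≠ 0 := by
  intro h0
  set ε₁ := u₀ - A₀ / N + τ with hε₁
  set ε₂ := u₁ - A₁ / N with hε₂
  set ε₃ := d₀ - B₀ / N with hε₃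
  set ε₄ := d₁ - B₁ / N with hε₄
  have hA₀ : (A₀ : ℝ) / N = u₀ + τ - ε₁ := by rw [hε₁]; ring
  have hA₁ : (A₁ : ℝ) / N = u₁ - ε₂ := by rw [hε₂]; ring
  have hB₀ : (B₀ : ℝ) / N = d₀ - ε₃ := by rw [hε₃]; ring
  have hB₁ : (B₁ : ℝ) / N = d₁ - ε₄ := by rw [hε₄]; ring
  set b := -(ε₁ * d₁) + ε₂ * d₀ - (A₀ / N) * ε₄ + (A₁ / N) * ε₃ with hb
  -- Since the true cross product is assumed to vanish, the lattice cross product consists of the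
  -- contribution of the shift and the approximation errors collected in `b`.
  have hcross : ((A₀ * B₁ - A₁ * B₀ : ℤ) : ℝ) / N ^ 2 = τ * d₁ + b := by
    have : ((A₀ * B₁ - A₁ * B₀ : ℤ) : ℝ) / N ^ 2 =
        (A₀ / N) * (B₁ / N) - (A₁ / N) * (B₀ / N) := by
      push_cast; field_simp
    rw [this, hb, hA₀, hA₁, hB₀, hB₁]
    linear_combination h0
  have hτ0 : 0 < τ := by rw [hτ]; positivity
  have hτ1 : τ ≤ 1 := by
    rw [hτ]; apply inv_le_one_of_one_le₀; nlinarith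
  have hN2 : N⁻¹ ^ 2 ≤ 1 := by
    rw [inv_pow]; exact inv_le_one_of_one_le₀ (one_le_pow₀ hN1)
  have hηle : η ≤ 1 := by linarith
  have hbA₀ : |(A₀ : ℝ) / N| ≤ 4 := by
    rw [hA₀]; refine (abs_sub _ _).trans ?_
    have := (abs_add_le u₀ τ); rw [abs_of_pos hτ0] at this; linarith
  have hbA₁ : |(A₁ : ℝ) / N| ≤ 4 := by
    rw [hA₁]; refine (abs_sub _ _).trans ?_; linarith
  have hbb : |b| ≤ 12 * η := by
    have e1 : |ε₁ * d₁| ≤ η * 2 := by rw [abs_mul]; gcongr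
    have e2 : |ε₂ * d₀| ≤ η * 2 := by rw [abs_mul]; gcongr
    have e3 : |(A₀ / N) * ε₄| ≤ 4 * η := by rw [abs_mul]; gcongr
    have e4 : |(A₁ / N) * ε₃| ≤ 4 * η := by rw [abs_mul]; gcongr
    rw [abs_le] at *
    constructor <;> rw [hb] <;> linarith
  have hτN : τ * N ^ 2 = 4⁻¹ := by rw [hτ]; field_simp
  have hNN : N⁻¹ ^ 2 * N ^ 2 = 1 := by field_simp
  have hN2' : 0 < N ^ 2 := by positivity
  have hbN : |b * N ^ 2| ≤ 12 * (η * N ^ 2) := by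
    rw [abs_mul, abs_of_pos hN2']; nlinarith
  have hη0' : 0 ≤ η * N ^ 2 := by positivity
  have hη1' : 32 * (η * N ^ 2) < 1 := by
    have := mul_lt_mul_of_pos_right hη1 hN2'; rw [hNN] at this; linarith
  have hη2' : 64 * (η * N ^ 2) < |d₁| := by
    have := mul_lt_mul_of_pos_right hη2 hN2'; rw [mul_assoc (|d₁|), hNN] at this; linarith
  have haN : |4⁻¹ * d₁| = 4⁻¹ * |d₁| := by rw [abs_mul]; norm_num
  -- After multiplication by `N ^ 2` the shift contributes `d₁ / 4`, of absolute value at most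
  -- `1/2`, and the error is strictly smaller.
  refine int_not_near (N := A₀ * B₁ - A₁ * B₀) (a := 4⁻¹ * d₁) (b := b * N ^ 2) ?_ ?_ ?_
  · rw [div_eq_iff hN2'.ne'] at hcross
    rw [hcross, ← hτN]; ring
  · rw [haN]; linarith
  · rw [haN]; linarith

theorem isShifted_pair_iff {a q k : ℕ} {g : ∀ i : Fin k, Digits m i} {c c' : Fin 2}
    (ha : e a = ⟨k, g, c'⟩) (x : DigitSeq m) :
    IsShifted e (Nat.pair a q) x c ↔ k ≤ Nat.pair a q ∧ c = c' ∧ ∀ i : Fin k, x i = g i := by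
  have h : e (Nat.pair a q).unpair.1 = ⟨k, g, c'⟩ := by rw [Nat.unpair_pair]; exact ha
  unfold IsShifted
  rw [h]

/-- If `x` is none of `y, z, w`, then the directions from `x` to `y` and from `z` to `w` differ. -/
theorem cross_planePoint_ne_zero (he : Function.Surjective e) {x y z w : DigitSeq m}
    (hxy : x ≠ y) (hxz : x ≠ z) (hxw : x ≠ w) (hzw : z ≠ w) :
    (planePoint e y 0 - planePoint e x 0) * (planePoint e w 1 - planePoint e z 1) -
      (planePoint e y 1 - planePoint e x 1) * (planePoint e w 0 - planePoint e z 0) ≠ 0 := by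
  obtain ⟨c, hc⟩ : ∃ c, planePoint e w c - planePoint e z c ≠ 0 := by
    by_contra! hcon
    exact hzw (planePoint_injective e (by ext c; linarith [hcon c]))
  obtain ⟨k, hky, hkz, hkw⟩ : ∃ k, (∃ i < k, x i ≠ y i) ∧ (∃ i < k, x i ≠ z i) ∧
      ∃ i < k, x i ≠ w i := by
    obtain ⟨i₁, h₁⟩ := Function.ne_iff.1 hxy
    obtain ⟨i₂, h₂⟩ := Function.ne_iff.1 hxz
    obtain ⟨i₃, h₃⟩ := Function.ne_iff.1 hxw
    exact ⟨i₁ + i₂ + i₃ + 1, ⟨i₁, by omega, h₁⟩, ⟨i₂, by omega, h₂⟩, ⟨i₃, by omega, h₃⟩⟩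
  -- A shift along one axis is multiplied in the cross product by the other coordinate of `w - z`.
  -- It is therefore taken along `c + 1`, the axis other than `c`, where `w` and `z` differ.
  obtain ⟨a, ha⟩ := he ⟨k, fun i => x i, c + 1⟩
  obtain ⟨p, hp⟩ : ∃ p : ℕ, (2⁻¹ : ℝ) ^ p < |planePoint e w c - planePoint e z c| :=
    exists_pow_lt_of_lt_one (abs_pos.2 hc) (by norm_num)
  -- A stage that uses prescription `a` and is at least `k + p`: past `k`, so that the prefix is
  -- available, and past `p`, so that the errors are small against coordinate `c` of `w - z`.
  let j := Nat.pair a (k + p)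
  have hj : k + p ≤ j := Nat.right_le_pair a (k + p)
  have hjx : IsShifted e j x (c + 1) :=
    (isShifted_pair_iff ha x).2 ⟨(Nat.le_add_right k p).trans hj, rfl, fun _ => rfl⟩
  have hne : ∀ c : Fin 2, c ≠ c + 1 := by decide
  have hjx' : ¬ IsShifted e j x c := fun h => hne c ((isShifted_pair_iff ha x).1 h).2.1
  have hj' : ∀ v : DigitSeq m, (∃ i < k, x i ≠ v i) → ∀ c, ¬ IsShifted e j v c := by
    rintro v ⟨i, hi, hne⟩ c' h
    exact hne (((isShifted_pair_iff ha v).1 h).2.2 ⟨i, hi⟩).symm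
  obtain ⟨X, hX⟩ := exists_lattice_approx e x j
  obtain ⟨Y, hY⟩ := exists_lattice_approx e y j
  obtain ⟨Z, hZ⟩ := exists_lattice_approx e z j
  obtain ⟨W, hW⟩ := exists_lattice_approx e w j
  have hv : ∀ v : DigitSeq m, (∃ i < k, x i ≠ v i) → ∀ c, shift e j v c = 0 := fun v h c =>
    if_neg (hj' v h c)
  have hs1 : shift e j x (c + 1) = (4 * ((2 : ℝ) ^ gridExp m j) ^ 2)⁻¹ := by
    rw [shift, if_pos hjx]; congr 1; rw [pow_add, mul_comm 2, pow_mul]; norm_num; ring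
  have hs0 : shift e j x c = 0 := if_neg hjx'
  set N : ℝ := 2 ^ gridExp m j with hN
  set η : ℝ := 4 * 2⁻¹ ^ scaleExp m (j + 1) with hη
  have hbd : ∀ v v' : DigitSeq m, ∀ c, |planePoint e v c - planePoint e v' c| ≤ 2 := fun v v' c =>
    abs_le.2 ⟨by linarith [planePoint_nonneg e v c, planePoint_le e v' c],
      by linarith [planePoint_nonneg e v' c, planePoint_le e v c]⟩
  have hηN : η = 4 * (N⁻¹ ^ 2 * 2⁻¹ ^ j * 2⁻¹ ^ 8) := by
    rw [hη, scaleExp_succ, pow_add, pow_add, mul_comm 2 (gridExp m j), pow_mul, hN, inv_pow 2]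
  have hN0 : 0 < N⁻¹ ^ 2 := by positivity
  have hη1 : 32 * η < N⁻¹ ^ 2 := by
    have : (2⁻¹ : ℝ) ^ j ≤ 1 := pow_le_one₀ (by norm_num) (by norm_num)
    rw [hηN]; nlinarith
  have hη2 : 64 * η < |planePoint e w c - planePoint e z c| * N⁻¹ ^ 2 := by
    have h1 : (2⁻¹ : ℝ) ^ j ≤ 2⁻¹ ^ p :=
      pow_le_pow_of_le_one (by norm_num) (by norm_num) (by omega)
    rw [hηN]; nlinarith
  have key := cross_ne_zero_of_lattice (N := N) (η := η) (τ := (4 * N ^ 2)⁻¹)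
    (u₀ := planePoint e y (c + 1) - planePoint e x (c + 1))
    (u₁ := planePoint e y c - planePoint e x c)
    (d₀ := planePoint e w (c + 1) - planePoint e z (c + 1))
    (d₁ := planePoint e w c - planePoint e z c) (A₀ := Y (c + 1) - X (c + 1)) (A₁ := Y c - X c)
    (B₀ := W (c + 1) - Z (c + 1)) (B₁ := W c - Z c) (by positivity) rfl (by positivity) hη1 hη2
    (one_le_pow₀ one_le_two) (hbd _ _ _) (hbd _ _ _) (hbd _ _ _) (hbd _ _ _)
  have hX1 := hX (c + 1); have hX0 := hX c
  have hY1 := hY (c + 1); have hY0 := hY c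
  have hZ1 := hZ (c + 1); have hZ0 := hZ c
  have hW1 := hW (c + 1); have hW0 := hW c
  rw [hs1] at hX1; rw [hs0] at hX0
  rw [hv y hky] at hY1 hY0; rw [hv z hkz] at hZ1 hZ0; rw [hv w hkw] at hW1 hW0
  have aux : ∀ {a b a' b' t η : ℝ}, |a - a' - 0| ≤ 2 * η → |b - b' - t| ≤ 2 * η →
      |a - b - (a' - b') + t| ≤ 4 * η := by
    intro a b a' b' t η h h'
    rw [abs_le] at *
    constructor <;> linarith
  have aux' : ∀ {a b a' b' η : ℝ}, |a - a' - 0| ≤ 2 * η → |b - b' - 0| ≤ 2 * η →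
      |a - b - (a' - b')| ≤ 4 * η := by
    intro a b a' b' η h h'
    simpa using aux h h'
  have key' := key (by push_cast; rw [sub_div]; exact aux hY1 hX1)
    (by push_cast; rw [sub_div]; exact aux' hY0 hX0)
    (by push_cast; rw [sub_div]; exact aux' hW1 hZ1)
    (by push_cast; rw [sub_div]; exact aux' hW0 hZ0)
  intro h0
  apply key'
  fin_cases c
  · simp only [Fin.mk_zero, zero_add] at *
    linarith
  · simp only [Fin.mk_one, Fin.reduceAdd] at *
    linarith

theorem cross_eq_zero_of_span_eq {u d : EuclideanSpace ℝ (Fin 2)}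
    (h : Submodule.span ℝ {u} = Submodule.span ℝ {d}) : u 0 * d 1 - u 1 * d 0 = 0 := by
  have : u ∈ Submodule.span ℝ {d} := h ▸ Submodule.mem_span_singleton_self u
  obtain ⟨t, rfl⟩ := Submodule.mem_span_singleton.1 this
  simp only [PiLp.smul_apply, smul_eq_mul]
  ring

/-- If the pairs differ, `x` or `y` lies outside `{z, w}` and can serve as the shifted point. Its
partner may coincide with `z` or `w`. -/
theorem directionsAtMostOnce_range_planePoint (he : Function.Surjective e) :
    DirectionsAtMostOnce (range (planePoint e)) := by
  rintro _ ⟨x, rfl⟩ _ ⟨y, rfl⟩ _ ⟨z, rfl⟩ _ ⟨w, rfl⟩ hxy hzw hspan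
  have hxy' : x ≠ y := fun h => hxy (by rw [h])
  have hzw' : z ≠ w := fun h => hzw (by rw [h])
  have hcross := cross_eq_zero_of_span_eq hspan
  simp only [PiLp.sub_apply] at hcross
  by_cases h1 : x = z
  · by_cases h2 : y = w
    · left; rw [h1, h2]; exact ⟨rfl, rfl⟩
    · exfalso
      subst h1
      refine cross_planePoint_ne_zero he (x := y) (y := x) (z := x) (w := w) hxy'.symm hxy'.symm
        h2 hzw' ?_
      linarith
  by_cases h2 : x = w
  · by_cases h3 : y = z
    · right; rw [h2, h3]; exact ⟨rfl, rfl⟩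
    · exfalso
      subst h2
      refine cross_planePoint_ne_zero he (x := y) (y := x) (z := z) (w := x) hxy'.symm h3
        hxy'.symm hzw' ?_
      linarith
  exact absurd hcross (cross_planePoint_ne_zero he hxy' h1 h2 hzw')

/-- Three collinear points would realise a direction twice. -/
theorem DirectionsAtMostOnce.noThreeCollinear {n : ℕ} {E : Set (EuclideanSpace ℝ (Fin n))}
    (h : DirectionsAtMostOnce E) : NoThreeCollinear E := by
  intro x hx y hy z hz hxy hyz hxz hcol
  rw [collinear_iff_of_mem (mem_insert x _)] at hcol
  obtain ⟨v, hv⟩ := hcol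
  obtain ⟨s, hs⟩ := hv y (by simp)
  obtain ⟨t, ht⟩ := hv z (by simp)
  simp only [vadd_eq_add] at hs ht
  have hs0 : s ≠ 0 := by rintro rfl; simp at hs; exact hxy hs.symm
  have ht0 : t ≠ 0 := by rintro rfl; simp at ht; exact hxz ht.symm
  have hspan : Submodule.span ℝ {y - x} = Submodule.span ℝ {z - x} := by
    rw [hs, ht, add_sub_cancel_right, add_sub_cancel_right,
      Submodule.span_singleton_smul_eq (IsUnit.mk0 _ hs0),
      Submodule.span_singleton_smul_eq (IsUnit.mk0 _ ht0)]
  rcases h x hx y hy x hx z hz hxy hxz hspan with ⟨-, h⟩ | ⟨h, -⟩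
  exacts [hyz h, hxz h]

end

/-! ### Counting the pieces near a ball -/

theorem Finset.card_le_prod_card_image {α : Type*} [Fintype α] [DecidableEq α] {β : α → Type*}
    [∀ a, DecidableEq (β a)] (T : Finset (∀ a, β a)) :
    T.card ≤ ∏ a, (T.image fun u => u a).card := by
  rw [← Fintype.card_piFinset]
  exact Finset.card_le_card fun u hu =>
    Fintype.mem_piFinset.2 fun a => Finset.mem_image_of_mem _ hu

theorem Finset.card_le_add_one_of_abs_sub_le {S : Finset ℕ} {ρ : ℝ} (hρ : 0 ≤ ρ)
    (h : ∀ u ∈ S, ∀ v ∈ S, |(u : ℝ) - v| ≤ ρ) : (S.card : ℝ) ≤ ρ + 1 := by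
  rcases S.eq_empty_or_nonempty with rfl | hne
  · simp only [Finset.card_empty, Nat.cast_zero]; positivity
  set a := S.min' hne
  have hsub : S ⊆ Finset.Icc a (a + ⌊ρ⌋₊) := by
    intro u hu
    have h1 : a ≤ u := Finset.min'_le _ _ hu
    have h2 := (le_abs_self _).trans (h u hu a (Finset.min'_mem _ _))
    refine Finset.mem_Icc.2 ⟨h1, ?_⟩
    have h3 : u - a ≤ ⌊ρ⌋₊ := Nat.le_floor (by rw [Nat.cast_sub h1]; exact h2)
    omega
  have h1 := Finset.card_le_card hsub
  rw [Nat.card_Icc] at h1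
  have h2 : S.card ≤ ⌊ρ⌋₊ + 1 := by omega
  calc (S.card : ℝ) ≤ (⌊ρ⌋₊ + 1 : ℕ) := by exact_mod_cast h2
    _ = ⌊ρ⌋₊ + 1 := by push_cast; rfl
    _ ≤ ρ + 1 := by gcongr; exact Nat.floor_le hρ

section

variable {m : ℕ} {e : ℕ → ShiftData m}

theorem card_digits_le_of_cellPos {j : ℕ} (T : Finset (Digits m j)) {ρ : ℝ} (hρ : 0 ≤ ρ)
    (h : ∀ i ∈ T, ∀ i' ∈ T, ∀ c, |(cellPos i c : ℝ) - cellPos i' c| ≤ ρ) :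
    (T.card : ℝ) ≤ (ρ + 1) ^ 2 := by
  classical
  have h1 := Finset.card_le_prod_card_image (T.image cellPos)
  rw [Finset.card_image_of_injective _ cellPos_injective] at h1
  calc (T.card : ℝ) ≤ ((∏ c, ((T.image cellPos).image fun u => u c).card : ℕ) : ℝ) := by
        exact_mod_cast h1
    _ = ∏ c : Fin 2, (((T.image cellPos).image fun u => u c).card : ℝ) := by push_cast; rfl
    _ ≤ ∏ _c : Fin 2, (ρ + 1) := by
        refine Finset.prod_le_prod (fun c _ => by positivity) fun c _ => ?_
        refine Finset.card_le_add_one_of_abs_sub_le hρ ?_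
        simp only [Finset.mem_image, exists_exists_and_eq_and]
        rintro _ ⟨i, hi, rfl⟩ _ ⟨i', hi', rfl⟩
        exact h i hi i' hi' c
    _ = _ := by simp

/-- Each digit in `P` is confined to at most `ρL + 1 ≤ 2ρL` values with `L = 2 ^ digitExp m j`; all
others are free. -/
theorem card_digits_le_of_digit {j : ℕ} (T : Finset (Digits m j)) (P : Finset (Fin m)) {ρ : ℝ}
    (hρ : 0 ≤ ρ) (h : ∀ i ∈ T, ∀ i' ∈ T, ∀ a ∈ P,
      |((i 0 a.castSucc : ℕ) : ℝ) - (i' 0 a.castSucc : ℕ)| ≤ ρ * 2 ^ digitExp m j)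
    (hρ1 : 1 ≤ ρ * 2 ^ digitExp m j) :
    (T.card : ℝ) ≤ (2 * ρ) ^ P.card * (2 ^ ((m + 1) * digitExp m j)) ^ 2 := by
  classical
  set L : ℝ := 2 ^ digitExp m j with hL
  have hL0 : 0 < L := by positivity
  have hcardFin : ∀ S : Finset (Fin (2 ^ digitExp m j)), (S.card : ℝ) ≤ L := by
    intro S
    have := S.card_le_univ
    rw [Fintype.card_fin] at this
    rw [hL]; exact_mod_cast this
  have hrow : ∀ S : Finset (Fin (m + 1) → Fin (2 ^ digitExp m j)),
      (∀ u ∈ S, ∀ v ∈ S, ∀ a ∈ P, |((u a.castSucc : ℕ) : ℝ) - (v a.castSucc : ℕ)| ≤ ρ * L) →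
      (S.card : ℝ) ≤ (2 * ρ) ^ P.card * L ^ (m + 1) := by
    intro S hS
    have h1 := Finset.card_le_prod_card_image S
    rw [Fin.prod_univ_castSucc] at h1
    calc (S.card : ℝ) ≤ (((∏ a : Fin m, (S.image fun u => u a.castSucc).card) *
          (S.image fun u => u (Fin.last m)).card : ℕ) : ℝ) := by exact_mod_cast h1
      _ = (∏ a : Fin m, ((S.image fun u => u a.castSucc).card : ℝ)) *
          (S.image fun u => u (Fin.last m)).card := by push_cast; rfl
      _ ≤ (∏ a : Fin m, (if a ∈ P then 2 * ρ else 1) * L) * L := by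
          gcongr with a
          · split_ifs with ha
            · have h2 := Finset.card_le_add_one_of_abs_sub_le
                (S := (S.image fun u => u a.castSucc).image Fin.val) (ρ := ρ * L)
                (by positivity) (by
                  simp only [Finset.mem_image, exists_exists_and_eq_and]
                  rintro _ ⟨u, hu, rfl⟩ _ ⟨v, hv, rfl⟩
                  exact hS u hu v hv a ha)
              rw [Finset.card_image_of_injective _ Fin.val_injective] at h2
              linarith
            · rw [one_mul]; exact hcardFin _
          · exact hcardFin _
      _ = _ := by
          rw [Finset.prod_mul_distrib, Finset.prod_ite_mem, Finset.univ_inter, Finset.prod_const,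
            Finset.prod_const, Finset.card_univ, Fintype.card_fin, pow_succ]
          ring
  have h1 := Finset.card_le_prod_card_image T
  rw [Fin.prod_univ_two] at h1
  calc (T.card : ℝ) ≤ ((T.image fun u => u 0).card : ℝ) * ((T.image fun u => u 1).card : ℝ) := by
        exact_mod_cast h1
    _ ≤ ((2 * ρ) ^ P.card * L ^ (m + 1)) * L ^ (m + 1) := by
        gcongr
        · refine hrow _ ?_
          simp only [Finset.mem_image]
          rintro _ ⟨u, hu, rfl⟩ _ ⟨v, hv, rfl⟩
          exact h u hu v hv
        · have := (T.image fun u => u 1).card_le_univ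
          rw [Fintype.card_fun, Fintype.card_fin, Fintype.card_fin] at this
          rw [hL]; exact_mod_cast this
    _ = _ := by rw [hL, ← pow_mul, mul_comm (m + 1)]; ring

theorem scaleExp_le_digitExp (j : ℕ) : scaleExp m j ≤ digitExp m j := by
  unfold digitExp; nlinarith

/-- The number of beginnings of sequences that give points at mutual distance at most `r`. -/
theorem card_le_of_dist_le {j : ℕ} {r : ℝ} (hr1 : 2⁻¹ ^ scaleExp m (j + 1) ≤ r)
    (hr2 : r < 2⁻¹ ^ scaleExp m j) (P : Finset (Fin m)) (W : Finset (DigitSeq m))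
    (hb : ∀ x ∈ W, ∀ y ∈ W, ∀ c, |planePoint e x c - planePoint e y c| ≤ r)
    (hF : ∀ x ∈ W, ∀ y ∈ W, ∀ a ∈ P, |heightPoint x a - heightPoint y a| ≤ r)
    (hW : ∀ x ∈ W, ∀ y ∈ W, ∀ i ≥ j + 2, x i = y i) :
    (W.card : ℝ) ≤ (2 * (2 ^ (j + 1) * r)) ^ P.card *
      (2 ^ ((m + 1) * digitExp m (j + 1))) ^ 2 * (5 * r * 2 ^ gridExp m j + 1) ^ 2 := by
  classical
  have hr0 : 0 < r := lt_of_lt_of_le (by positivity) hr1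
  have hlow : ∀ x ∈ W, ∀ y ∈ W, ∀ i < j, x i = y i := by
    intro x hx y hy i hi
    by_contra hne
    obtain ⟨k, hk, hk'⟩ := exists_first_difference (show x ≠ y from fun h => hne (by rw [h]))
    have hkj : k < j := by
      by_contra! hcon
      exact hne (hk i (hi.trans_le hcon))
    obtain ⟨c, hc⟩ := exists_two_pow_le_abs_planePoint_sub e hk hk'
    have h1 : (2⁻¹ : ℝ) ^ scaleExp m j ≤ 2⁻¹ ^ scaleExp m (k + 1) :=
      pow_le_pow_of_le_one (by norm_num) (by norm_num) (scaleExp_strictMono.monotone hkj)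
    linarith [hb x hx y hy c]
  -- Once the digits of stage `j` are fixed, only those of stage `j + 1` vary, and the height
  -- condition restricts them directly.
  have hfib : ∀ i ∈ W.image (fun x => x j), ((W.filter fun x => x j = i).card : ℝ) ≤
      (2 * (2 ^ (j + 1) * r)) ^ P.card * (2 ^ ((m + 1) * digitExp m (j + 1))) ^ 2 := by
    intro i _
    have heq : ∀ x ∈ W.filter fun x => x j = i, ∀ y ∈ W.filter fun x => x j = i,
        ∀ k, k ≠ j + 1 → x k = y k := by
      intro x hx y hy k hk
      rw [Finset.mem_filter] at hx hy
      rcases lt_trichotomy k j with h | rfl | h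
      · exact hlow x hx.1 y hy.1 k h
      · rw [hx.2, hy.2]
      · exact hW x hx.1 y hy.1 k (by omega)
    have hinj : InjOn (fun x : DigitSeq m => x (j + 1)) (W.filter fun x => x j = i) := by
      intro x hx y hy hxy
      funext k
      by_cases hk : k = j + 1
      · subst hk; exact hxy
      · exact heq x hx y hy k hk
    rw [← Finset.card_image_of_injOn hinj]
    refine card_digits_le_of_digit _ P (by positivity) ?_ ?_
    · simp only [Finset.mem_image]
      rintro _ ⟨x, hx, rfl⟩ _ ⟨y, hy, rfl⟩ a ha
      have h1 := hF x (Finset.mem_filter.1 hx).1 y (Finset.mem_filter.1 hy).1 a ha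
      rw [heightPoint_sub_eq (heq x hx y hy), abs_div, abs_mul,
        abs_of_pos (show (0 : ℝ) < 2 ^ digitExp m (j + 1) by positivity),
        abs_of_pos (show (0 : ℝ) < 2⁻¹ ^ (j + 1) by positivity), div_le_iff₀ (by positivity),
        inv_pow, inv_mul_le_iff₀ (by positivity)] at h1
      rw [mul_assoc]; exact h1
    · have h1 : (1 : ℝ) ≤ 2 ^ (j + 1) := one_le_pow₀ one_le_two
      have h2 : 1 ≤ r * 2 ^ digitExp m (j + 1) := by
        calc (1 : ℝ) = 2⁻¹ ^ scaleExp m (j + 1) * 2 ^ scaleExp m (j + 1) := by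
              rw [← mul_pow]; norm_num
          _ ≤ r * 2 ^ digitExp m (j + 1) := by
              gcongr
              · norm_num
              · exact scaleExp_le_digitExp _
      rw [mul_assoc]
      nlinarith
  have himg : ((W.image fun x => x j).card : ℝ) ≤ (5 * r * 2 ^ gridExp m j + 1) ^ 2 := by
    refine card_digits_le_of_cellPos _ (by positivity) ?_
    simp only [Finset.mem_image]
    rintro _ ⟨x, hx, rfl⟩ _ ⟨y, hy, rfl⟩ c
    have h1 := abs_planePoint_sub_sub_le e (hlow x hx y hy) c
    have h2 := hb x hx y hy c
    have h3 : |((cellPos (x j) c : ℝ) - cellPos (y j) c) / 2 ^ gridExp m j| ≤ 5 * r := by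
      rw [abs_le] at *
      constructor <;> linarith
    rwa [abs_div, abs_of_pos (show (0 : ℝ) < 2 ^ gridExp m j by positivity),
      div_le_iff₀ (by positivity)] at h3
  rw [Finset.card_eq_sum_card_image (fun x : DigitSeq m => x j) W]
  push_cast
  calc _ ≤ ∑ i ∈ W.image (fun x => x j), ((2 * (2 ^ (j + 1) * r)) ^ P.card *
        (2 ^ ((m + 1) * digitExp m (j + 1))) ^ 2) := Finset.sum_le_sum hfib
    _ ≤ _ := by
        rw [Finset.sum_const, nsmul_eq_mul, mul_comm]
        gcongr

theorem card_digits (j : ℕ) :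
    Fintype.card (Digits m j) = (2 ^ ((m + 1) * digitExp m j)) ^ 2 := by
  simp only [Digits, Fintype.card_fun, Fintype.card_fin]
  rw [← pow_mul 2, mul_comm (m + 1)]

theorem two_mul_le_scaleExp_succ (i : ℕ) :
    2 * ((i + 1) * (scaleExp m i + 1)) ≤ scaleExp m (i + 1) := by
  have h1 : digitExp m i = (i + 1) * (scaleExp m i + 1) := rfl
  have := digitExp_le_gridExp (m := m) i
  rw [scaleExp_succ]
  omega

theorem two_pow_mul_pow_le_one {a b k : ℕ} {r : ℝ} (hr0 : 0 ≤ r) (hr : r ≤ 2⁻¹ ^ a)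
    (h : b ≤ k * a) : (2 : ℝ) ^ b * r ^ k ≤ 1 := by
  calc (2 : ℝ) ^ b * r ^ k ≤ 2 ^ (k * a) * (2⁻¹ ^ a) ^ k := by
        gcongr; norm_num
    _ = 1 := by rw [← pow_mul, mul_comm a, ← mul_pow]; norm_num

/-- The number of pieces of stage `j` that meet a ball of radius `r` is, up to a factor that is
negligible when `j` is large, at most `r` times the number of all pieces. -/
theorem exists_sq_le_mul_prod {j : ℕ} (hj : 1 ≤ j) {r : ℝ}
    (hr1 : 2⁻¹ ^ scaleExp m (j + 1) ≤ r) (hr2 : r < 2⁻¹ ^ scaleExp m j) : ∃ err : ℕ,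
      (5 * r * 2 ^ gridExp m j + 1) ^ 2 ≤ 36 * r * 2 ^ err *
        ∏ i ∈ Finset.range (j + 1), ((2 : ℝ) ^ ((m + 1) * digitExp m i)) ^ 2 ∧
      (2 ^ err) ^ j * r ^ 8 ≤ 1 := by
  have hr0 : 0 < r := lt_of_lt_of_le (by positivity) hr1
  obtain ⟨i, rfl⟩ : ∃ i, j = i + 1 := ⟨j - 1, by omega⟩
  have hi : i ≤ scaleExp m i := scaleExp_strictMono.id_le i
  have hi' : i + 1 ≤ scaleExp m (i + 1) := scaleExp_strictMono.id_le (i + 1)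
  have hge : ∀ (f : ℕ → ℝ) n, (∀ i, 1 ≤ f i) → 1 ≤ ∏ i ∈ Finset.range n, f i := fun f n hf =>
    Finset.one_le_prod fun i _ => hf i
  have hone : ∀ i, (1 : ℝ) ≤ (2 ^ ((m + 1) * digitExp m i)) ^ 2 := fun i =>
    one_le_pow₀ (one_le_pow₀ one_le_two)
  -- Above the mesh, the square of the number of meshes in `r` is compared with the pieces using `r`
  -- below the side of stage `j`. Below the mesh the count is at most 36, and `r` is at least the
  -- next side. The excess `2 ^ err` of an inverse side over a number of choices comes from the
  -- stage before in the first case and from the current one in the second. It is negligible because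
  -- `digitExp` carries the factor `j + 1`.
  by_cases hcase : 1 ≤ r * 2 ^ gridExp m (i + 1)
  · refine ⟨2 * scaleExp m i + i + 8, ?_, ?_⟩
    · rw [Finset.prod_range_succ, Finset.prod_range_succ]
      have h1 := hge _ i hone
      have hexp : scaleExp m (i + 1) + scaleExp m (i + 1) + 2 * ((m + 1) * digitExp m (i + 1)) =
          2 * gridExp m (i + 1) := by unfold gridExp; ring
      have hexp2 : scaleExp m (i + 1) =
          (2 * scaleExp m i + i + 8) + 2 * ((m + 1) * digitExp m i) := by
        rw [scaleExp_succ]; unfold gridExp; ring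
      have hA : r * 2 ^ scaleExp m (i + 1) ≤ 1 := by
        calc _ ≤ (2⁻¹ : ℝ) ^ scaleExp m (i + 1) * 2 ^ scaleExp m (i + 1) := by gcongr
          _ = 1 := by rw [← mul_pow]; norm_num
      set M : ℝ := (2 ^ ((m + 1) * digitExp m (i + 1))) ^ 2 with hM
      set M' : ℝ := (2 ^ ((m + 1) * digitExp m i)) ^ 2 with hM'
      have hN2 : ((2 : ℝ) ^ gridExp m (i + 1)) ^ 2 =
          2 ^ scaleExp m (i + 1) * 2 ^ scaleExp m (i + 1) * M := by
        rw [hM, ← pow_mul, ← pow_mul, ← pow_add, ← pow_add]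
        congr 1
        omega
      have hS : (2 : ℝ) ^ scaleExp m (i + 1) = 2 ^ (2 * scaleExp m i + i + 8) * M' := by
        rw [hM', ← pow_mul, ← pow_add]
        congr 1
        omega
      calc (5 * r * 2 ^ gridExp m (i + 1) + 1) ^ 2
          ≤ (6 * (r * 2 ^ gridExp m (i + 1))) ^ 2 := by gcongr; linarith
        _ = 36 * r * (r * 2 ^ scaleExp m (i + 1)) * 2 ^ scaleExp m (i + 1) * M := by
            rw [mul_pow, mul_pow, hN2]; ring
        _ ≤ 36 * r * 1 * 2 ^ scaleExp m (i + 1) * M := by gcongr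
        _ = 36 * r * 2 ^ (2 * scaleExp m i + i + 8) * (1 * M' * M) := by rw [hS]; ring
        _ ≤ _ := by gcongr
    · rw [← pow_mul]
      refine two_pow_mul_pow_le_one hr0.le hr2.le ?_
      have := two_mul_le_scaleExp_succ (m := m) i
      nlinarith
  · push Not at hcase
    refine ⟨2 * scaleExp m (i + 1) + (i + 1) + 8, ?_, ?_⟩
    · rw [Finset.prod_range_succ]
      have h1 := hge _ (i + 1) hone
      set M : ℝ := (2 ^ ((m + 1) * digitExp m (i + 1))) ^ 2 with hM
      have hexp : scaleExp m (i + 1 + 1) = (2 * scaleExp m (i + 1) + (i + 1) + 8) +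
          2 * ((m + 1) * digitExp m (i + 1)) := by
        rw [scaleExp_succ]; unfold gridExp; ring
      have hS : (2 : ℝ) ^ scaleExp m (i + 1 + 1) =
          2 ^ (2 * scaleExp m (i + 1) + (i + 1) + 8) * M := by
        rw [hM, ← pow_mul, ← pow_add]
        congr 1
        omega
      calc (5 * r * 2 ^ gridExp m (i + 1) + 1) ^ 2 ≤ 6 ^ 2 := by gcongr; linarith
        _ = 36 * (2⁻¹ ^ scaleExp m (i + 1 + 1) * 2 ^ scaleExp m (i + 1 + 1)) := by
            rw [← mul_pow]; norm_num
        _ ≤ 36 * (r * 2 ^ scaleExp m (i + 1 + 1)) := by gcongr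
        _ = 36 * r * 2 ^ (2 * scaleExp m (i + 1) + (i + 1) + 8) * (1 * M) := by rw [hS]; ring
        _ ≤ _ := by gcongr
    · rw [← pow_mul]
      have hr3 : r ≤ 2⁻¹ ^ gridExp m (i + 1) := by
        rw [inv_pow, ← one_div, le_div_iff₀ (by positivity)]; exact hcase.le
      refine two_pow_mul_pow_le_one hr0.le hr3 ?_
      have h1 := digitExp_le_gridExp (m := m) (i + 1)
      have h2 : digitExp m (i + 1) = (i + 1 + 1) * (scaleExp m (i + 1) + 1) := rfl
      nlinarith

end

/-! ### Mass distribution and lower bounds for the dimension -/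

section

variable {m : ℕ} {e : ℕ → ShiftData m}

theorem exists_scale_of_lt {j₀ : ℕ} {r : ℝ} (hr0 : 0 < r) (hr : r < 2⁻¹ ^ scaleExp m j₀) :
    ∃ j ≥ j₀, 2⁻¹ ^ scaleExp m (j + 1) ≤ r ∧ r < 2⁻¹ ^ scaleExp m j := by
  classical
  have hex : ∃ k, 2⁻¹ ^ scaleExp m k ≤ r := by
    obtain ⟨k, hk⟩ := exists_pow_lt_of_lt_one hr0 (by norm_num : (2⁻¹ : ℝ) < 1)
    exact ⟨k, (pow_le_pow_of_le_one (by norm_num) (by norm_num)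
      (scaleExp_strictMono.id_le k)).trans hk.le⟩
  have hfind := Nat.find_spec hex
  have hlt : j₀ < Nat.find hex := by
    by_contra! hcon
    have : (2⁻¹ : ℝ) ^ scaleExp m j₀ ≤ 2⁻¹ ^ scaleExp m (Nat.find hex) :=
      pow_le_pow_of_le_one (by norm_num) (by norm_num) (scaleExp_strictMono.monotone hcon)
    linarith
  refine ⟨Nat.find hex - 1, by omega, ?_, ?_⟩
  · rwa [Nat.sub_add_cancel (by omega)]
  · exact not_le.1 (Nat.find_min hex (by omega))

/-- A factor whose powers grow slowly is negligible. -/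
theorem le_rpow_neg_of_pow_mul_le_one {T r ε : ℝ} {j q : ℕ} (hj : 1 ≤ j) (hr0 : 0 < r) (hr1 : r ≤ 1)
    (h : T ^ j * r ^ q ≤ 1) (hε : q ≤ ε * j) : T ≤ r ^ (-ε) := by
  refine le_of_pow_le_pow_left₀ (by omega : j ≠ 0) (by positivity) ?_
  rw [← Real.rpow_natCast (r ^ (-ε)), ← Real.rpow_mul hr0.le]
  calc T ^ j ≤ (r ^ q)⁻¹ := by rwa [← one_div, le_div_iff₀ (by positivity)]
    _ = r ^ (-(q : ℝ)) := by rw [Real.rpow_neg hr0.le, Real.rpow_natCast]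
    _ ≤ r ^ (-ε * j) := Real.rpow_le_rpow_of_exponent_ge hr0 hr1 (by linarith)

/-- The mass distribution estimate for the image of the uniform measure on sequences of digits. -/
theorem exists_measure_le_rpow [MeasurableSpace (DigitSeq m)] {μ : Measure (DigitSeq m)}
    [IsProbabilityMeasure μ]
    (hμ : ∀ (J : ℕ) (A : Set (DigitSeq m)) (M : ℕ), MeasurableSet A →
        (∀ W : Finset (DigitSeq m), (∀ x ∈ W, x ∈ A) →
          (∀ x ∈ W, ∀ y ∈ W, ∀ i ≥ J, x i = y i) → W.card ≤ M) →
        μ A * ((∏ i ∈ Finset.range J, Fintype.card (Digits m i) : ℕ) : ℝ≥0∞) ≤ M)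
    (P : Finset (Fin m)) {d : ℝ} (hd : d < P.card + 1) :
    ∃ r₀ > 0, ∀ A : Set (DigitSeq m), MeasurableSet A → ∀ r, 0 < r → r < r₀ →
      (∀ x ∈ A, ∀ y ∈ A, ∀ c, |planePoint e x c - planePoint e y c| ≤ r) →
      (∀ x ∈ A, ∀ y ∈ A, ∀ a ∈ P, |heightPoint x a - heightPoint y a| ≤ r) →
      μ.real A ≤ r ^ d := by
  set p := P.card with hp
  obtain ⟨ε, hε, hdε⟩ : ∃ ε > 0, d = p + 1 - ε - ε := ⟨(p + 1 - d) / 2, by linarith, by ring⟩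
  obtain ⟨j₀, hj₀⟩ := exists_nat_ge ((8 * p + 8) / ε)
  rw [div_le_iff₀ hε] at hj₀
  have hj₀1 : 1 ≤ j₀ := by
    by_contra! hcon
    have : j₀ = 0 := by omega
    rw [this, Nat.cast_zero, zero_mul] at hj₀
    exact absurd hj₀ (not_le.2 (by positivity))
  -- Two losses of `r ^ (-ε)` are allowed. The first bound on `r` makes the stage late enough to
  -- absorb the growing factor `T`, the second absorbs the constant 36.
  refine ⟨min (2⁻¹ ^ scaleExp m j₀) (36 ^ (-ε⁻¹)), by positivity, fun A hA r hr0 hr hb hF => ?_⟩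
  rw [lt_min_iff] at hr
  obtain ⟨j, hj, hr1, hr2⟩ := exists_scale_of_lt hr0 hr.1
  have hj1 : 1 ≤ j := hj₀1.trans hj
  have hrle : r ≤ 1 := hr2.le.trans (pow_le_one₀ (by norm_num) (by norm_num))
  obtain ⟨err, herr, herr'⟩ := exists_sq_le_mul_prod hj1 hr1 hr2
  set Q : ℝ := ∏ i ∈ Finset.range (j + 1), ((2 : ℝ) ^ ((m + 1) * digitExp m i)) ^ 2 with hQ
  have hQ0 : 0 < Q := Finset.prod_pos fun i _ => by positivity
  set V : ℝ := (2 ^ ((m + 1) * digitExp m (j + 1))) ^ 2 with hV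
  have hV0 : 0 < V := by positivity
  set G : ℝ := (2 * (2 ^ (j + 1) * r)) ^ p * V * (5 * r * 2 ^ gridExp m j + 1) ^ 2 with hG
  have hG0 : 0 ≤ G := by positivity
  have h1 := hμ (j + 2) A ⌊G⌋₊ hA fun W hWA hW => Nat.le_floor
    (card_le_of_dist_le hr1 hr2 P W (fun x hx y hy => hb x (hWA x hx) y (hWA y hy))
      (fun x hx y hy => hF x (hWA x hx) y (hWA y hy)) hW)
  have h2 : μ.real A * (Q * V) ≤ G := by
    have h3 := ENNReal.toReal_mono (by simp) h1
    rw [ENNReal.toReal_mul, ENNReal.toReal_natCast, ENNReal.toReal_natCast,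
      Finset.prod_range_succ] at h3
    simp only [card_digits] at h3
    push_cast at h3
    exact h3.trans (Nat.floor_le hG0)
  set T : ℝ := (2 ^ (j + 2)) ^ p * 2 ^ err with hT
  have h4 : μ.real A ≤ 36 * T * r ^ (p + 1) := by
    have h5 : G ≤ 36 * T * r ^ (p + 1) * (Q * V) := by
      calc G ≤ (2 * (2 ^ (j + 1) * r)) ^ p * V * (36 * r * 2 ^ err * Q) := by
            rw [hG]; gcongr
        _ = _ := by rw [hT, ← mul_assoc 2, ← pow_succ', mul_pow _ r]; ring
    exact le_of_mul_le_mul_right (h2.trans h5) (by positivity)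
  have hT' : T ≤ r ^ (-ε) := by
    refine le_rpow_neg_of_pow_mul_le_one (q := 8 * p + 8) hj1 hr0 hrle ?_ ?_
    · have h6 : (2 : ℝ) ^ ((j + 2) * p * j) * r ^ (8 * p) ≤ 1 := by
        refine two_pow_mul_pow_le_one hr0.le hr2.le ?_
        obtain ⟨i, rfl⟩ : ∃ i, j = i + 1 := ⟨j - 1, by omega⟩
        have h7 := two_mul_le_scaleExp_succ (m := m) i
        have h8 : i ≤ scaleExp m i := scaleExp_strictMono.id_le i
        have h9 : (i + 1 + 2) * (i + 1) ≤ 8 * scaleExp m (i + 1) := by nlinarith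
        calc (i + 1 + 2) * p * (i + 1) = p * ((i + 1 + 2) * (i + 1)) := by ring
          _ ≤ p * (8 * scaleExp m (i + 1)) := by gcongr
          _ = _ := by ring
      calc T ^ j * r ^ (8 * p + 8) =
            (2 ^ ((j + 2) * p * j) * r ^ (8 * p)) * ((2 ^ err) ^ j * r ^ 8) := by
            rw [hT, mul_pow, ← pow_mul, ← pow_mul, pow_add r]; ring
        _ ≤ 1 := mul_le_one₀ h6 (by positivity) herr'
    · push_cast
      calc (8 * p + 8 : ℝ) ≤ j₀ * ε := hj₀
        _ ≤ j * ε := by gcongr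
        _ = ε * j := mul_comm _ _
  have h36 : 36 ≤ r ^ (-ε) := by
    calc (36 : ℝ) = (36 ^ (-ε⁻¹)) ^ (-ε) := by
          rw [← Real.rpow_mul (by norm_num), neg_mul_neg, inv_mul_cancel₀ hε.ne', Real.rpow_one]
      _ ≤ r ^ (-ε) := Real.rpow_le_rpow_of_nonpos hr0 hr.2.le (by linarith)
  calc μ.real A ≤ 36 * T * r ^ (p + 1) := h4
    _ ≤ r ^ (-ε) * r ^ (-ε) * r ^ (p + 1) := by gcongr
    _ = r ^ d := by
        rw [← Real.rpow_natCast, ← Real.rpow_add hr0, ← Real.rpow_add hr0, hdε]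
        congr 1; push_cast; ring

/-- A lower bound for the dimension of a set on which the sequences of digits can be read off in a
Lipschitz way. -/
theorem le_dimH_range {Y : Type*} [MetricSpace Y] {Φ : DigitSeq m → Y} (hΦ : Continuous Φ)
    (P : Finset (Fin m))
    (hb : ∀ x y c, |planePoint e x c - planePoint e y c| ≤ dist (Φ x) (Φ y))
    (hF : ∀ x y, ∀ a ∈ P, |heightPoint x a - heightPoint y a| ≤ dist (Φ x) (Φ y)) :
    ((P.card + 1 : ℕ) : ℝ≥0∞) ≤ dimH (range Φ) := by
  refine ENNReal.le_of_forall_nnreal_lt fun d hd => ?_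
  have hd' : (d : ℝ) < P.card + 1 := by exact_mod_cast hd
  rcases eq_or_lt_of_le (zero_le (a := d)) with rfl | hd0
  · simp
  let _ : MeasurableSpace Y := borel Y
  have : BorelSpace Y := ⟨rfl⟩
  let _ : MeasurableSpace (DigitSeq m) := borel _
  have : BorelSpace (DigitSeq m) := ⟨rfl⟩
  obtain ⟨μ, hμp, hμ⟩ := exists_isProbabilityMeasure_mul_prod_card_le (Digits m)
  obtain ⟨r₀, hr₀, hr⟩ := exists_measure_le_rpow (e := e) hμ P hd'
  have hle : μ.map Φ ≤ μH[d] := by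
    refine Measure.le_hausdorffMeasure d _ (ENNReal.ofReal (r₀ / 2))
      (ENNReal.ofReal_pos.2 (by positivity)) fun S hS => ?_
    set D := (Metric.ediam S).toReal with hD
    have hfin : Metric.ediam S ≠ ⊤ := ne_top_of_le_ne_top ENNReal.ofReal_ne_top hS
    have hDr : D < r₀ := by
      have := ENNReal.toReal_mono ENNReal.ofReal_ne_top hS
      rw [ENNReal.toReal_ofReal (by positivity)] at this
      linarith
    have hD0 : 0 ≤ D := ENNReal.toReal_nonneg
    -- The diameter may vanish while the estimate needs a positive radius, so it is applied to `r >
    -- D` and then `r → D`. Passing to the closure makes the set measurable.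
    have hbound : ∀ r ∈ Ioo D r₀, μ.map Φ S ≤ ENNReal.ofReal r ^ (d : ℝ) := by
      intro r hrD
      have hr0 : 0 < r := hD0.trans_lt hrD.1
      refine (measure_mono subset_closure).trans ?_
      rw [Measure.map_apply hΦ.measurable isClosed_closure.measurableSet,
        ENNReal.ofReal_rpow_of_pos hr0]
      have hdist : ∀ x ∈ Φ ⁻¹' closure S, ∀ y ∈ Φ ⁻¹' closure S, dist (Φ x) (Φ y) ≤ r := by
        intro x hx y hy
        have h1 : edist (Φ x) (Φ y) ≤ Metric.ediam S := by
          rw [← Metric.ediam_closure]; exact Metric.edist_le_ediam_of_mem hx hy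
        have h2 := ENNReal.toReal_mono hfin h1
        rw [← dist_edist] at h2
        exact h2.trans hrD.1.le
      have := hr _ (hΦ.measurable isClosed_closure.measurableSet) r hr0 hrD.2
        (fun x hx y hy c => (hb x y c).trans (hdist x hx y hy))
        (fun x hx y hy a ha => (hF x y a ha).trans (hdist x hx y hy))
      rw [← ofReal_measureReal]
      exact ENNReal.ofReal_le_ofReal this
    have hlim : Tendsto (fun r => ENNReal.ofReal r ^ (d : ℝ)) (𝓝[>] D)
        (𝓝 (ENNReal.ofReal D ^ (d : ℝ))) :=
      ((ENNReal.continuous_rpow_const.comp ENNReal.continuous_ofReal).tendsto D).mono_left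
        nhdsWithin_le_nhds
    rw [← ENNReal.ofReal_toReal hfin]
    exact ge_of_tendsto hlim (by
      filter_upwards [Ioo_mem_nhdsGT hDr] with r hr using hbound r hr)
  refine le_dimH_of_hausdorffMeasure_ne_zero (d := d) fun h0 => ?_
  have h1 := hle (range Φ)
  rw [h0, Measure.map_apply hΦ.measurable (isCompact_range hΦ).measurableSet, preimage_range,
    measure_univ] at h1
  exact absurd h1 (by simp)

end

/-! ### The graph over the planar set -/

section Graph

variable {m : ℕ} (e : ℕ → ShiftData m)

/-- The point of the graph with a given sequence of digits. -/
noncomputable def graphPoint (x : DigitSeq m) : EuclideanSpace ℝ (Fin (m + 2)) :=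
  WithLp.toLp 2 fun i => if h : i.val < 2 then planePoint e x ⟨i, h⟩ else
    heightPoint x ⟨i.val - 2, by omega⟩

theorem planeProj_graphPoint (hn : 2 ≤ m + 2) (x : DigitSeq m) :
    planeProj hn (graphPoint e x) = planePoint e x := by
  ext c
  exact dif_pos c.2

theorem graphPoint_add_two (x : DigitSeq m) (i : Fin m) (h : i.val + 2 < m + 2) :
    graphPoint e x ⟨i.val + 2, h⟩ = heightPoint x i := by
  simp [graphPoint]

theorem continuous_graphPoint : Continuous (graphPoint e) := by
  refine (PiLp.continuous_toLp 2 _).comp (continuous_pi fun i => ?_)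
  have h1 := continuous_planePoint e
  have h2 := continuous_heightPoint (m := m)
  split_ifs with h
  · exact (PiLp.continuous_apply 2 _ _).comp h1
  · exact (PiLp.continuous_apply 2 _ _).comp h2

/-- The projection to the plane as a linear map. -/
def planeProjLinear {n : ℕ} (hn : 2 ≤ n) :
    EuclideanSpace ℝ (Fin n) →ₗ[ℝ] EuclideanSpace ℝ (Fin 2) where
  toFun := planeProj hn
  map_add' _ _ := rfl
  map_smul' _ _ := rfl

/-- A set that projects injectively to a planar set with at most one pair in each direction has
itself at most one pair in each direction. -/
theorem DirectionsAtMostOnce.of_planeProj {n : ℕ} (hn : 2 ≤ n)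
    {E : Set (EuclideanSpace ℝ (Fin n))} {B : Set (EuclideanSpace ℝ (Fin 2))}
    (hB : DirectionsAtMostOnce B) (hE : MapsTo (planeProj hn) E B)
    (hinj : InjOn (planeProj hn) E) : DirectionsAtMostOnce E := by
  intro x hx y hy z hz w hw hxy hzw hspan
  have h := congrArg (Submodule.map (planeProjLinear hn)) hspan
  rw [Submodule.map_span, Submodule.map_span, image_singleton, image_singleton, map_sub,
    map_sub] at h
  rcases hB _ (hE hx) _ (hE hy) _ (hE hz) _ (hE hw) (fun h => hxy (hinj hx hy h))
    (fun h => hzw (hinj hz hw h)) h with ⟨h1, h2⟩ | ⟨h1, h2⟩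
  · exact Or.inl ⟨hinj hx hz h1, hinj hy hw h2⟩
  · exact Or.inr ⟨hinj hx hw h1, hinj hy hz h2⟩

theorem range_graphPoint (hn : 2 ≤ m + 2) : range (graphPoint e) =
    graphOver hn (range (planePoint e)) fun p =>
      heightPoint (Function.invFun (planePoint e) p) := by
  have hinv : ∀ x, Function.invFun (planePoint e) (planePoint e x) = x :=
    Function.leftInverse_invFun (planePoint_injective e)
  ext p
  constructor
  · rintro ⟨x, rfl⟩
    refine ⟨⟨x, (planeProj_graphPoint e hn x).symm⟩, fun i => ?_⟩
    rw [planeProj_graphPoint]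
    beta_reduce
    rw [hinv]
    exact graphPoint_add_two e x i _
  · rintro ⟨⟨x, hx⟩, hf⟩
    refine ⟨x, ?_⟩
    ext i
    by_cases hi : i.val < 2
    · have : graphPoint e x i = planePoint e x ⟨i, hi⟩ := dif_pos hi
      rw [this, hx]
      rfl
    · have h1 := hf ⟨i.val - 2, by omega⟩
      rw [← hx] at h1
      beta_reduce at h1
      rw [hinv] at h1
      have h2 : i = ⟨i.val - 2 + 2, by omega⟩ := Fin.ext (by simp; omega)
      have : graphPoint e x i = heightPoint x ⟨i.val - 2, by omega⟩ := dif_neg hi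
      rw [this, ← h1]
      exact congrArg p h2.symm

/-- An injective continuous map on a compact space is an embedding, so the digits depend
continuously on the point. -/
theorem continuousOn_heightPoint_invFun :
    ContinuousOn (fun p => heightPoint (Function.invFun (planePoint e) p))
      (range (planePoint e)) := by
  have hemb := ((continuous_planePoint e).isClosedEmbedding (planePoint_injective e)).isEmbedding
  rw [continuousOn_iff_continuous_domRestrict]
  have : (range (planePoint e)).domRestrict
      (fun p => heightPoint (Function.invFun (planePoint e) p)) =
      heightPoint ∘ hemb.toHomeomorph.symm := by
    funext p
    obtain ⟨x, rfl⟩ := hemb.toHomeomorph.surjective p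
    simp only [domRestrict_apply, Function.comp, Homeomorph.symm_apply_apply]
    exact congrArg heightPoint (Function.leftInverse_invFun (planePoint_injective e) x)
  rw [this]
  exact continuous_heightPoint.comp hemb.toHomeomorph.symm.continuous

theorem abs_sub_apply_le_dist {n : ℕ} (x y : EuclideanSpace ℝ (Fin n)) (i : Fin n) :
    |x i - y i| ≤ dist x y := by
  rw [dist_eq_norm]
  exact PiLp.norm_apply_le (x - y) i

theorem one_le_dimH_range_planePoint : 1 ≤ dimH (range (planePoint e)) := by
  have := le_dimH_range (e := e) (continuous_planePoint e) ∅
    (fun x y c => abs_sub_apply_le_dist _ _ c) (fun _ _ _ h => absurd h (Finset.notMem_empty _))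
  simpa using this

theorem le_dimH_range_graphPoint : ((m + 1 : ℕ) : ℝ≥0∞) ≤ dimH (range (graphPoint e)) := by
  have := le_dimH_range (e := e) (continuous_graphPoint e) Finset.univ
    (fun x y c => by
      rw [← planeProj_graphPoint e (by omega) x, ← planeProj_graphPoint e (by omega) y]
      exact abs_sub_apply_le_dist (graphPoint e x) (graphPoint e y) _)
    (fun x y a _ => by
      rw [← graphPoint_add_two e x a (by omega), ← graphPoint_add_two e y a (by omega)]
      exact abs_sub_apply_le_dist _ _ _)
  simpa using this

end Graph

/-! ### The main theorem -/

theorem theorem4p2 (n : ℕ) (hn : 2 ≤ n) :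
    (∃ E : Set (EuclideanSpace ℝ (Fin n)),
      IsCompact E ∧ dimH E = ((n - 1 : ℕ) : ENNReal) ∧
      NoThreeCollinear E ∧ DirectionsAtMostOnce E ∧
      ∃ (B : Set (EuclideanSpace ℝ (Fin 2)))
        (f : EuclideanSpace ℝ (Fin 2) → EuclideanSpace ℝ (Fin (n - 2))),
        IsCompact B ∧ dimH B = 1 ∧ NoThreeCollinear B ∧ DirectionsAtMostOnce B ∧
        ContinuousOn f B ∧ E = graphOver hn B f) ∧
    (∀ A : Set (EuclideanSpace ℝ (Fin n)), MeasurableSet A → NoThreeCollinear A →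
      dimH A ≤ ((n - 1 : ℕ) : ENNReal)) := by
  obtain ⟨m, rfl⟩ : ∃ m, n = m + 2 := ⟨n - 2, by omega⟩
  refine ⟨?_, fun A hA hA3 => dimH_le_of_noThreeCollinear (m := m + 1) hA hA3⟩
  obtain ⟨e, he⟩ := exists_surjective_shiftData m
  have hB := directionsAtMostOnce_range_planePoint he
  have hBc : IsCompact (range (planePoint e)) := isCompact_range (continuous_planePoint e)
  have hEc : IsCompact (range (graphPoint e)) := isCompact_range (continuous_graphPoint e)
  have hE : DirectionsAtMostOnce (range (graphPoint e)) := by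
    refine hB.of_planeProj hn ?_ ?_
    · rintro _ ⟨x, rfl⟩
      exact ⟨x, (planeProj_graphPoint e hn x).symm⟩
    · rintro _ ⟨x, rfl⟩ _ ⟨y, rfl⟩ h
      rw [planeProj_graphPoint, planeProj_graphPoint] at h
      rw [planePoint_injective e h]
  -- The upper bounds for both dimensions are instances of part (b): in the ambient space for the
  -- graph, in the plane for its base.
  refine ⟨range (graphPoint e), hEc, le_antisymm
    (dimH_le_of_noThreeCollinear (m := m + 1) hEc.measurableSet hE.noThreeCollinear)
    (le_dimH_range_graphPoint e), hE.noThreeCollinear, hE, range (planePoint e), _, hBc,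
    le_antisymm ?_ (one_le_dimH_range_planePoint e), hB.noThreeCollinear, hB,
    continuousOn_heightPoint_invFun e, range_graphPoint e hn⟩
  simpa using dimH_le_of_noThreeCollinear (m := 1) hBc.measurableSet hB.noThreeCollinear
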